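/- All algebras are complex and unital. A CQG algebra is a Hopf $*$-algebra (a Hopf algebra that is a $*$-algebra and whose comultiplication and counit are $*$-homomorphisms) which is the linear span of the coefficients of its finite-dimensional unitary comodules; $\mathrm{CQG}$ is the category of CQG algebras and Hopf $*$-algebra morphisms. A compact quantum group is a pair $(A,\Delta)$ with $A$ a unital $C^*$-algebra (the zero algebra is allowed) and $\Delta:A\to A\otimes A$ a coassociative unital $*$-homomorphism into the minimal tensor product such that the linear spans of $\Delta(A)(1\otimes A)$ and $\Delta(A)(A\otimes 1)$ are dense in $A\otimes A$; $\mathrm{C^*QG}$ is the category of compact quantum groups and unital $*$-homomorphisms $f$ with $(f\otimes f)\Delta_A=\Delta_B f$. Let $\mathrm{CQG}_{ab}\subset\mathrm{CQG}$ and $\mathrm{C^*QG}_{ab}\subset\mathrm{C^*QG}$ be the full subcategories of objects with commutative algebra. 1. The inclusions $\mathrm{CQG}_{ab}\to\mathrm{CQG}$ and $\mathrm{C^*QG}_{ab}\to\mathrm{C^*QG}$ are right adjoints. In both cases the left adjoint is abelianization: the unit $\pi:A\to A_{ab}$ of the adjunction is the largest commutative quotient of the underlying $*$-algebra (resp. $C^*$-algebra),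 i.e. $\pi$ is surjective, $A_{ab}$ is commutative, and every unital $*$-homomorphism from $A$ to a commutative unital $*$-algebra (resp. $C^*$-algebra) factors uniquely through $\pi$. 2. Consequently, in $\mathrm{CQG}$ and in $\mathrm{C^*QG}$, if a diagram with commutative values has a limit, then this limit is commutative; and a cone in the subcategory of commutative objects is a limit cone there if and only if it is a limit cone in the big category. 3. Consequently, limits of commutative diagrams recover colimits of compact groups. For a compact Hausdorff group $G$ let $\mathcal O(G)\in\mathrm{CQG}$ be the algebra of representative functions (the span of the matrix coefficients of finite-dimensional continuous unitary representations) and $C(G)\in\mathrm{C^*QG}$ the algebra of continuous functions, both with $(\Delta f)(g,h)=f(gh)$. If $G=\varinjlim_j G_j$ is a colimit of a diagram of compact Hausdorff groups and continuous homomorphisms, then $\mathcal O(G)$, with the pullback maps $\mathcal O(G)\to\mathcal O(G_j)$ along the structure maps $G_j\to G$, is the limit of the $\mathcal O(G_j)$ in $\mathrm{CQG}$; and, if the index category is non-empty, $C(G)$ is likewise the limit of the $C(G_j)$ in $\mathrm{C^*QG}$. -/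

import Mathlib

open scoped TensorProduct
open CategoryTheory

universe u v w

noncomputable section

section MinTensor

variable {A B : Type u} [CStarAlgebra A] [CStarAlgebra B]
  {H K : Type u} [NormedAddCommGroup H] [InnerProductSpace ℂ H] [CompleteSpace H]
  [NormedAddCommGroup K] [InnerProductSpace ℂ K] [CompleteSpace K]

/-- For unital `*`-representations `π` of `A` on `H` and `σ` of `B` on `K`, the representation
`a ⊗ b ↦ π a ⊗ σ b` of the algebraic tensor product on the pre-Hilbert space `H ⊗ K`. (The norms of
these operators are those of their extensions to the completed Hilbert space tensor product.) -/
def tensorRep (π : A →⋆ₐ[ℂ] (H →L[ℂ] H)) (σ : B →⋆ₐ[ℂ] (K →L[ℂ] K)) :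
    A ⊗[ℂ] B →ₐ[ℂ] (H ⊗[ℂ] K →L[ℂ] H ⊗[ℂ] K) :=
  Algebra.TensorProduct.lift
    { toFun := fun a => (π a).rTensor K
      map_one' := by simp
      map_mul' := fun a b => by rw [map_mul, ContinuousLinearMap.rTensor_mul]
      map_zero' := by simp
      map_add' := fun a b => by simp
      commutes' := fun r => by
        simp [Algebra.algebraMap_eq_smul_one] }
    { toFun := fun b => (σ b).lTensor H
      map_one' := by simp
      map_mul' := fun a b => by rw [map_mul, ContinuousLinearMap.lTensor_mul]
      map_zero' := by simp
      map_add' := fun a b => by simp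
      commutes' := fun r => by
        simp [Algebra.algebraMap_eq_smul_one] }
    (fun a b => by
      change (π a).rTensor K ∘L (σ b).lTensor H = (σ b).lTensor H ∘L (π a).rTensor K
      simp)
lemma tensorRep_tmul (π : A →⋆ₐ[ℂ] (H →L[ℂ] H)) (σ : B →⋆ₐ[ℂ] (K →L[ℂ] K)) (a : A) (b : B) :
    tensorRep π σ (a ⊗ₜ b) = TensorProduct.mapL (π a) (σ b) := by
  change (π a).rTensor K ∘L (σ b).lTensor H = _
  simp

lemma tensorRep_adjoint (π : A →⋆ₐ[ℂ] (H →L[ℂ] H)) (σ : B →⋆ₐ[ℂ] (K →L[ℂ] K)) (t : A ⊗[ℂ] B)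
    (x y : H ⊗[ℂ] K) :
    inner ℂ (tensorRep π σ (star t) x) y = inner ℂ x (tensorRep π σ t y) := by
  induction t using TensorProduct.induction_on with
  | zero => simp
  | add s t hs ht => simp [inner_add_left, inner_add_right, hs, ht]
  | tmul a b =>
    rw [TensorProduct.star_tmul, tensorRep_tmul, tensorRep_tmul]
    induction x using TensorProduct.induction_on with
    | zero => simp
    | add s t hs ht => simp only [map_add, inner_add_left, hs, ht]
    | tmul h k =>
      induction y using TensorProduct.induction_on with
      | zero => simp
      | add s t hs ht => simp only [map_add, inner_add_right, hs, ht]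
      | tmul h' k' =>
        simp [map_star, ContinuousLinearMap.star_eq_adjoint, ContinuousLinearMap.adjoint_inner_left]

lemma tensorRep_cstar (π : A →⋆ₐ[ℂ] (H →L[ℂ] H)) (σ : B →⋆ₐ[ℂ] (K →L[ℂ] K)) (t : A ⊗[ℂ] B) :
    ‖tensorRep π σ t‖ ^ 2 ≤ ‖tensorRep π σ (star t * t)‖ := by
  have h : ‖tensorRep π σ t‖ ≤ Real.sqrt ‖tensorRep π σ (star t * t)‖ := by
    refine ContinuousLinearMap.opNorm_le_bound _ (Real.sqrt_nonneg _) fun x => ?_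
    refine Real.le_sqrt_of_sq_le ?_ |>.trans_eq
      (b := Real.sqrt (‖tensorRep π σ (star t * t)‖ * ‖x‖ ^ 2)) ?_
    · have h1 : ‖tensorRep π σ t x‖ ^ 2 = ‖inner ℂ (tensorRep π σ (star t * t) x) x‖ := by
        rw [map_mul, mul_apply_eq_comp, tensorRep_adjoint,
          inner_self_eq_norm_sq_to_K (𝕜 := ℂ) (E := H ⊗[ℂ] K)]
        simp
      rw [h1]
      refine (norm_inner_le_norm (𝕜 := ℂ) (E := H ⊗[ℂ] K) _ _).trans ?_
      rw [sq, ← mul_assoc]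
      exact mul_le_mul_of_nonneg_right (ContinuousLinearMap.le_opNorm _ _) (norm_nonneg x)
    · rw [Real.sqrt_mul (ContinuousLinearMap.opNorm_nonneg _),
        Real.sqrt_sq (norm_nonneg x)]
  calc _ ≤ (Real.sqrt ‖tensorRep π σ (star t * t)‖) ^ 2 := by gcongr
    _ = _ := Real.sq_sqrt (ContinuousLinearMap.opNorm_nonneg _)

/-- The values at `t` of the norms of all representations `π ⊗ σ`. -/
def minNormSet (t : A ⊗[ℂ] B) : Set ℝ :=
  {r | ∃ (H K : Type u) (_ : NormedAddCommGroup H) (_ : InnerProductSpace ℂ H)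
    (_ : CompleteSpace H) (_ : NormedAddCommGroup K) (_ : InnerProductSpace ℂ K)
    (_ : CompleteSpace K) (π : A →⋆ₐ[ℂ] (H →L[ℂ] H)) (σ : B →⋆ₐ[ℂ] (K →L[ℂ] K)),
    r = ‖tensorRep π σ t‖}

/-- The minimal (spatial) `C*`-norm on the algebraic tensor product of two `C*`-algebras:
the supremum of `‖(π ⊗ σ) t‖` over all pairs of representations. -/
def minNorm (t : A ⊗[ℂ] B) : ℝ := sSup (minNormSet t)

lemma minNormSet_bdd (t : A ⊗[ℂ] B) : BddAbove (minNormSet t) := by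
  suffices h : ∃ C : ℝ, ∀ (H K : Type u) (_ : NormedAddCommGroup H) (_ : InnerProductSpace ℂ H)
    (_ : CompleteSpace H) (_ : NormedAddCommGroup K) (_ : InnerProductSpace ℂ K)
    (_ : CompleteSpace K) (π : A →⋆ₐ[ℂ] (H →L[ℂ] H)) (σ : B →⋆ₐ[ℂ] (K →L[ℂ] K)),
    ‖tensorRep π σ t‖ ≤ C by
    obtain ⟨C, hC⟩ := h
    refine ⟨C, ?_⟩
    rintro r ⟨H, K, i1, i2, i3, i4, i5, i6, π, σ, rfl⟩
    exact hC _ _ _ _ _ _ _ _ _ _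
  induction t using TensorProduct.induction_on with
  | zero => exact ⟨0, by intros; rw [map_zero, ContinuousLinearMap.opNorm_zero]⟩
  | add s t hs ht =>
    obtain ⟨C, hC⟩ := hs
    obtain ⟨D, hD⟩ := ht
    refine ⟨C + D, fun H K _ _ _ _ _ _ π σ => ?_⟩
    rw [map_add]
    exact (ContinuousLinearMap.opNorm_add_le _ _).trans
      (add_le_add (hC _ _ _ _ _ _ _ _ _ _) (hD _ _ _ _ _ _ _ _ _ _))
  | tmul a b =>
    refine ⟨‖a‖ * ‖b‖, fun H K _ _ _ _ _ _ π σ => ?_⟩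
    rw [tensorRep_tmul]
    exact (TensorProduct.norm_mapL_le _ _).trans
      (mul_le_mul (NonUnitalStarAlgHom.norm_apply_le π a) (NonUnitalStarAlgHom.norm_apply_le σ b)
        (norm_nonneg _) (norm_nonneg _))

lemma le_minNorm (π : A →⋆ₐ[ℂ] (H →L[ℂ] H)) (σ : B →⋆ₐ[ℂ] (K →L[ℂ] K)) (t : A ⊗[ℂ] B) :
    ‖tensorRep π σ t‖ ≤ minNorm t :=
  le_csSup (minNormSet_bdd t) ⟨H, K, _, _, _, _, _, _, π, σ, rfl⟩

lemma minNorm_nonneg (t : A ⊗[ℂ] B) : 0 ≤ minNorm t := by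
  apply Real.sSup_nonneg
  rintro r ⟨H, K, i1, i2, i3, i4, i5, i6, π, σ, rfl⟩
  exact ContinuousLinearMap.opNorm_nonneg _

lemma minNorm_le {t : A ⊗[ℂ] B} {C : ℝ} (hC : 0 ≤ C)
    (h : ∀ (H K : Type u) (_ : NormedAddCommGroup H) (_ : InnerProductSpace ℂ H)
    (_ : CompleteSpace H) (_ : NormedAddCommGroup K) (_ : InnerProductSpace ℂ K)
    (_ : CompleteSpace K) (π : A →⋆ₐ[ℂ] (H →L[ℂ] H)) (σ : B →⋆ₐ[ℂ] (K →L[ℂ] K)),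
    ‖tensorRep π σ t‖ ≤ C) : minNorm t ≤ C := by
  apply Real.sSup_le _ hC
  rintro r ⟨H, K, i1, i2, i3, i4, i5, i6, π, σ, rfl⟩
  exact h _ _ _ _ _ _ _ _ _ _

lemma minNorm_add_le (s t : A ⊗[ℂ] B) : minNorm (s + t) ≤ minNorm s + minNorm t :=
  minNorm_le (add_nonneg (minNorm_nonneg _) (minNorm_nonneg _)) fun H K _ _ _ _ _ _ π σ => by
    rw [map_add]
    exact (ContinuousLinearMap.opNorm_add_le _ _).trans (add_le_add (le_minNorm _ _ _) (le_minNorm _ _ _))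

lemma minNorm_mul_le (s t : A ⊗[ℂ] B) : minNorm (s * t) ≤ minNorm s * minNorm t :=
  minNorm_le (mul_nonneg (minNorm_nonneg _) (minNorm_nonneg _)) fun H K _ _ _ _ _ _ π σ => by
    rw [map_mul]
    exact (ContinuousLinearMap.opNorm_comp_le _ _).trans
      (mul_le_mul (le_minNorm _ _ _) (le_minNorm _ _ _) (ContinuousLinearMap.opNorm_nonneg _) (minNorm_nonneg _))

lemma minNorm_smul_le (c : ℂ) (t : A ⊗[ℂ] B) : minNorm (c • t) ≤ ‖c‖ * minNorm t :=
  minNorm_le (mul_nonneg (norm_nonneg _) (minNorm_nonneg _)) fun H K _ _ _ _ _ _ π σ => by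
    rw [map_smul]
    exact (ContinuousLinearMap.opNorm_smul_le _ _).trans <| mul_le_mul_of_nonneg_left (le_minNorm _ _ _) (norm_nonneg c)

lemma minNorm_sq_le (t : A ⊗[ℂ] B) : minNorm t ^ 2 ≤ minNorm (star t * t) := by
  have : minNorm t ≤ Real.sqrt (minNorm (star t * t)) :=
    minNorm_le (Real.sqrt_nonneg _) fun H K _ _ _ _ _ _ π σ =>
      Real.le_sqrt_of_sq_le ((tensorRep_cstar π σ t).trans (le_minNorm _ _ _))
  calc _ ≤ (Real.sqrt (minNorm (star t * t))) ^ 2 :=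
        pow_le_pow_left₀ (minNorm_nonneg _) this 2
    _ = _ := Real.sq_sqrt (minNorm_nonneg _)

lemma minNorm_star_le (t : A ⊗[ℂ] B) : minNorm (star t) ≤ minNorm t := by
  have h1 := minNorm_sq_le (star t)
  rw [star_star] at h1
  have h2 := minNorm_mul_le t (star t)
  have h3 := minNorm_nonneg t
  have h4 := minNorm_nonneg (star t)
  by_contra h
  push Not at h
  nlinarith

lemma minNorm_zero : minNorm (0 : A ⊗[ℂ] B) = 0 :=
  le_antisymm (minNorm_le le_rfl fun H K _ _ _ _ _ _ π σ => by
    rw [map_zero, ContinuousLinearMap.opNorm_zero]) (minNorm_nonneg _)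


lemma minNorm_smul (c : ℂ) (t : A ⊗[ℂ] B) : minNorm (c • t) = ‖c‖ * minNorm t := by
  refine le_antisymm (minNorm_smul_le c t) ?_
  by_cases hc : c = 0
  · subst hc
    simpa using minNorm_nonneg ((0 : ℂ) • t)
  have h := minNorm_smul_le c⁻¹ (c • t)
  rw [smul_smul, inv_mul_cancel₀ hc, one_smul, norm_inv] at h
  have hc' : 0 < ‖c‖ := norm_pos_iff.mpr hc
  calc _ ≤ ‖c‖ * (‖c‖⁻¹ * minNorm (c • t)) := by gcongr
    _ = _ := by field_simp

lemma minNorm_star (t : A ⊗[ℂ] B) : minNorm (star t) = minNorm t :=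
  le_antisymm (minNorm_star_le t) (by
    have h := minNorm_star_le (star t)
    rwa [star_star] at h)

/-- The algebraic tensor product `A ⊗ B`, as a type carrying the minimal `C*`-norm. -/
def AlgTensor (A B : Type u) [CStarAlgebra A] [CStarAlgebra B] : Type u := A ⊗[ℂ] B

namespace AlgTensor

instance : Ring (AlgTensor A B) := inferInstanceAs (Ring (A ⊗[ℂ] B))
instance : Algebra ℂ (AlgTensor A B) := inferInstanceAs (Algebra ℂ (A ⊗[ℂ] B))
instance : StarRing (AlgTensor A B) := inferInstanceAs (StarRing (A ⊗[ℂ] B))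
instance : StarModule ℂ (AlgTensor A B) := inferInstanceAs (StarModule ℂ (A ⊗[ℂ] B))
instance : Norm (AlgTensor A B) := ⟨fun t => minNorm (A := A) (B := B) t⟩

instance : SeminormedRing (AlgTensor A B) :=
  { (inferInstance : Ring (AlgTensor A B)), (inferInstance : Norm (AlgTensor A B)),
    SeminormedAddCommGroup.ofCore (𝕜 := ℂ) (E := AlgTensor A B)
      { norm_nonneg := fun t => minNorm_nonneg (A := A) (B := B) t
        norm_smul := fun c t => minNorm_smul (A := A) (B := B) c t
        norm_triangle := fun s t => minNorm_add_le (A := A) (B := B) s t } with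
    norm_mul_le := fun s t => minNorm_mul_le (A := A) (B := B) s t }

lemma norm_def (t : AlgTensor A B) : ‖t‖ = minNorm (A := A) (B := B) t := rfl

instance : NormedAlgebra ℂ (AlgTensor A B) where
  norm_smul_le c t := minNorm_smul_le (A := A) (B := B) c t

lemma norm_star (t : AlgTensor A B) : ‖star t‖ = ‖t‖ := minNorm_star (A := A) (B := B) t

instance : NormedStarGroup (AlgTensor A B) := ⟨fun t => (norm_star t).le⟩

end AlgTensor

open UniformSpace

/-- The minimal tensor product of two unital `C*`-algebras: the completion of the algebraic
tensor product for the minimal `C*`-norm. -/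
def MinTensor (A B : Type u) [CStarAlgebra A] [CStarAlgebra B] : Type u :=
  Completion (AlgTensor A B)

namespace MinTensor

instance : NormedRing (MinTensor A B) := inferInstanceAs (NormedRing (Completion (AlgTensor A B)))
instance : Algebra ℂ (MinTensor A B) := inferInstanceAs (Algebra ℂ (Completion (AlgTensor A B)))
instance : CompleteSpace (MinTensor A B) :=
  inferInstanceAs (CompleteSpace (Completion (AlgTensor A B)))

/-- The canonical map from the algebraic tensor product. -/
def coe (t : A ⊗[ℂ] B) : MinTensor A B := ((show AlgTensor A B from t : AlgTensor A B) :
  Completion (AlgTensor A B))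

lemma norm_coe (t : A ⊗[ℂ] B) : ‖(coe t : MinTensor A B)‖ = minNorm t :=
  Completion.norm_coe (E := AlgTensor A B) t

lemma denseRange_coe : DenseRange (coe : A ⊗[ℂ] B → MinTensor A B) :=
  Completion.denseRange_coe (α := AlgTensor A B)

@[elab_as_elim]
lemma induction {p : MinTensor A B → Prop} (x : MinTensor A B) (hc : IsClosed {x | p x})
    (h : ∀ t : A ⊗[ℂ] B, p (coe t)) : p x :=
  denseRange_coe.induction_on x hc h

lemma coe_add (s t : A ⊗[ℂ] B) : (coe (s + t) : MinTensor A B) = coe s + coe t :=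
  Completion.coe_add (α := AlgTensor A B) s t
lemma coe_mul (s t : A ⊗[ℂ] B) : (coe (s * t) : MinTensor A B) = coe s * coe t :=
  Completion.coe_mul (α := AlgTensor A B) s t
lemma coe_smul (c : ℂ) (t : A ⊗[ℂ] B) : (coe (c • t) : MinTensor A B) = c • coe t :=
  Completion.coe_smul (M := ℂ) (X := AlgTensor A B) c t
lemma coe_one : (coe (1 : A ⊗[ℂ] B) : MinTensor A B) = 1 := rfl
lemma coe_zero : (coe (0 : A ⊗[ℂ] B) : MinTensor A B) = 0 := rfl

instance : NormedAlgebra ℂ (MinTensor A B) where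
  norm_smul_le c x := by
    induction x using MinTensor.induction with
    | hc => exact isClosed_le (continuous_norm.comp (continuous_const_smul (T := MinTensor A B) c))
              (continuous_const.mul continuous_norm)
    | h t =>
      rw [← coe_smul, norm_coe, norm_coe]
      exact minNorm_smul_le c t

instance : Star (MinTensor A B) := ⟨Completion.map (star : AlgTensor A B → AlgTensor A B)⟩

lemma coe_star (t : A ⊗[ℂ] B) : (coe (star t) : MinTensor A B) = star (coe t) :=
  (Completion.map_coe (star_isometry (E := AlgTensor A B)).uniformContinuous t).symm

instance : ContinuousStar (MinTensor A B) :=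
  ⟨Completion.continuous_map (f := (star : AlgTensor A B → AlgTensor A B))⟩

instance : StarRing (MinTensor A B) where
  star_involutive x := by
    induction x using MinTensor.induction with
    | hc => exact isClosed_eq (continuous_star.comp continuous_star) continuous_id
    | h t => rw [← coe_star, ← coe_star, star_star]
  star_mul x y := by
    induction x using MinTensor.induction with
    | hc => exact isClosed_eq (continuous_star.comp (continuous_mul_const y))
              ((continuous_const_mul (star y)).comp continuous_star)
    | h s =>
      induction y using MinTensor.induction with
      | hc => exact isClosed_eq (continuous_star.comp (continuous_const_mul _))
                ((continuous_mul_const _).comp continuous_star)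
      | h t => rw [← coe_star, ← coe_star, ← coe_mul, ← coe_mul, ← coe_star, star_mul]
  star_add x y := by
    induction x using MinTensor.induction with
    | hc => exact isClosed_eq (continuous_star.comp (continuous_add_const y))
              ((continuous_add_const (star y)).comp continuous_star)
    | h s =>
      induction y using MinTensor.induction with
      | hc => exact isClosed_eq (continuous_star.comp (continuous_const_add _))
                ((continuous_const_add _).comp continuous_star)
      | h t => rw [← coe_star, ← coe_star, ← coe_add, ← coe_add, ← coe_star, star_add]

instance : CStarAlgebra (MinTensor A B) where
  norm_mul_self_le x := by
    induction x using MinTensor.induction with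
    | hc => exact isClosed_le (continuous_norm.mul continuous_norm)
              (continuous_norm.comp (continuous_star.mul continuous_id))
    | h t =>
      rw [← coe_star, ← coe_mul, norm_coe, norm_coe, ← sq]
      exact minNorm_sq_le t
  star_smul c x := by
    induction x using MinTensor.induction with
    | hc => exact isClosed_eq (continuous_star.comp (continuous_const_smul c))
              ((continuous_const_smul (star c)).comp continuous_star)
    | h t => rw [← coe_smul, ← coe_star, ← coe_star, ← coe_smul, star_smul]

/-- The canonical `*`-homomorphism from the algebraic tensor product. -/
def coeHom : A ⊗[ℂ] B →⋆ₐ[ℂ] MinTensor A B where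
  toFun := coe
  map_one' := coe_one
  map_mul' := coe_mul
  map_zero' := coe_zero
  map_add' := coe_add
  commutes' c := by
    rw [Algebra.algebraMap_eq_smul_one, coe_smul, coe_one, Algebra.algebraMap_eq_smul_one]
  map_star' := coe_star

/-- The elementary tensor `a ⊗ b` in the minimal tensor product. -/
def tmul (a : A) (b : B) : MinTensor A B := coeHom (a ⊗ₜ b)

lemma coeHom_apply (t : A ⊗[ℂ] B) : (coeHom t : MinTensor A B) = coe t := rfl

lemma span_tmul_dense :
    Dense (Submodule.span ℂ {x : MinTensor A B | ∃ a b, x = tmul a b} : Set (MinTensor A B)) := by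
  refine (denseRange_coe (A := A) (B := B)).mono ?_
  rintro _ ⟨t, rfl⟩
  induction t using TensorProduct.induction_on with
  | zero => exact coe_zero (A := A) (B := B) ▸ Submodule.zero_mem _
  | add s t hs ht => exact coe_add s t ▸ Submodule.add_mem _ hs ht
  | tmul a b => exact Submodule.subset_span ⟨a, b, rfl⟩

/-- Two continuous linear maps that agree on elementary tensors are equal. -/
lemma ext_tmul {E : Type*} [AddCommGroup E] [Module ℂ E] [TopologicalSpace E] [T2Space E]
    {f g : MinTensor A B →ₗ[ℂ] E} (hf : Continuous f) (hg : Continuous g)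
    (h : ∀ a b, f (tmul a b) = g (tmul a b)) (x : MinTensor A B) : f x = g x := by
  refine congrFun (Continuous.ext_on span_tmul_dense hf hg fun y hy => ?_) x
  exact LinearMap.eqOn_span (f := f) (g := g) (by rintro _ ⟨a, b, rfl⟩; exact h a b) hy

/-- Extension of a contractive `*`-homomorphism to the completion, as a ring homomorphism. -/
def liftRing {C : Type*} [CStarAlgebra C] (φ : A ⊗[ℂ] B →⋆ₐ[ℂ] C)
    (h : ∀ t, ‖φ t‖ ≤ minNorm t) : MinTensor A B →+* C :=
  Completion.extensionHom (α := AlgTensor A B) (φ : A ⊗[ℂ] B →+* C)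
    (AddMonoidHomClass.continuous_of_bound (E := AlgTensor A B) (φ : A ⊗[ℂ] B →+* C) 1
      (fun t => by rw [one_mul, AlgTensor.norm_def]; exact h t))

lemma liftRing_coe {C : Type*} [CStarAlgebra C] (φ : A ⊗[ℂ] B →⋆ₐ[ℂ] C)
    (h : ∀ t, ‖φ t‖ ≤ minNorm t) (t : A ⊗[ℂ] B) : liftRing φ h (coe t) = φ t :=
  Completion.extensionHom_coe (α := AlgTensor A B) (φ : A ⊗[ℂ] B →+* C) _ t

lemma continuous_liftRing {C : Type*} [CStarAlgebra C] (φ : A ⊗[ℂ] B →⋆ₐ[ℂ] C)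
    (h : ∀ t, ‖φ t‖ ≤ minNorm t) : Continuous (liftRing φ h) :=
  Completion.continuous_extension (α := AlgTensor A B)

/-- Extension of a contractive `*`-homomorphism from the algebraic to the minimal tensor
product. -/
def lift {C : Type*} [CStarAlgebra C] (φ : A ⊗[ℂ] B →⋆ₐ[ℂ] C) (h : ∀ t, ‖φ t‖ ≤ minNorm t) :
    MinTensor A B →⋆ₐ[ℂ] C :=
  { liftRing φ h with
    commutes' := fun c => by
      have h1 := liftRing_coe φ h (algebraMap ℂ _ c)
      rw [AlgHomClass.commutes] at h1
      have h2 : (coe (algebraMap ℂ (A ⊗[ℂ] B) c) : MinTensor A B) = algebraMap ℂ _ c :=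
        (coeHom (A := A) (B := B)).commutes' c
      rw [h2] at h1
      exact h1
    map_star' := fun x => by
      change liftRing φ h (star x) = star (liftRing φ h x)
      induction x using MinTensor.induction with
      | hc => exact isClosed_eq ((continuous_liftRing φ h).comp continuous_star)
                (continuous_star.comp (continuous_liftRing φ h))
      | h t => rw [← coe_star, liftRing_coe, liftRing_coe, map_star] }

lemma lift_coe {C : Type*} [CStarAlgebra C] (φ : A ⊗[ℂ] B →⋆ₐ[ℂ] C) (h : ∀ t, ‖φ t‖ ≤ minNorm t)
    (t : A ⊗[ℂ] B) : lift φ h (coe t) = φ t := liftRing_coe φ h t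

lemma continuous_starAlgHom {C D : Type*} [CStarAlgebra C] [CStarAlgebra D] (f : C →⋆ₐ[ℂ] D) :
    Continuous f :=
  AddMonoidHomClass.continuous_of_bound f 1 fun x => by
    rw [one_mul]; exact NonUnitalStarAlgHom.norm_apply_le f x

lemma ext {C : Type*} [CStarAlgebra C] {f g : MinTensor A B →⋆ₐ[ℂ] C}
    (h : ∀ a b, f (tmul a b) = g (tmul a b)) : f = g :=
  StarAlgHom.ext fun x => ext_tmul (f := f.toAlgHom.toLinearMap) (g := g.toAlgHom.toLinearMap)
    (continuous_starAlgHom f) (continuous_starAlgHom g) h x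

variable {A' B' : Type u} [CStarAlgebra A'] [CStarAlgebra B']

/-- The algebraic tensor product of two `*`-homomorphisms. -/
def algMap (f : A →⋆ₐ[ℂ] A') (g : B →⋆ₐ[ℂ] B') : A ⊗[ℂ] B →⋆ₐ[ℂ] A' ⊗[ℂ] B' :=
  { Algebra.TensorProduct.map f.toAlgHom g.toAlgHom with
    map_star' := fun t => by
      change Algebra.TensorProduct.map f.toAlgHom g.toAlgHom (star t) =
        star (Algebra.TensorProduct.map f.toAlgHom g.toAlgHom t)
      induction t using TensorProduct.induction_on with
      | zero => simp
      | add s t hs ht => rw [star_add, map_add, map_add, hs, ht, star_add]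
      | tmul a b => simp [map_star] }

lemma algMap_tmul (f : A →⋆ₐ[ℂ] A') (g : B →⋆ₐ[ℂ] B') (a : A) (b : B) :
    algMap f g (a ⊗ₜ b) = f a ⊗ₜ g b := rfl

lemma minNorm_algMap_le (f : A →⋆ₐ[ℂ] A') (g : B →⋆ₐ[ℂ] B') (t : A ⊗[ℂ] B) :
    minNorm (algMap f g t) ≤ minNorm t := by
  refine minNorm_le (minNorm_nonneg t) fun H K _ _ _ _ _ _ π σ => ?_
  have h : tensorRep π σ (algMap f g t) = tensorRep (π.comp f) (σ.comp g) t := by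
    induction t using TensorProduct.induction_on with
    | zero => simp
    | add s t hs ht => rw [map_add, map_add, map_add, hs, ht]
    | tmul a b => rw [algMap_tmul, tensorRep_tmul, tensorRep_tmul]; rfl
  rw [h]
  exact le_minNorm _ _ _

/-- The `*`-homomorphism `f ⊗ g` between minimal tensor products. -/
def map (f : A →⋆ₐ[ℂ] A') (g : B →⋆ₐ[ℂ] B') : MinTensor A B →⋆ₐ[ℂ] MinTensor A' B' :=
  lift (coeHom.comp (algMap f g)) fun t => by
    rw [StarAlgHom.comp_apply, coeHom_apply, norm_coe]
    exact minNorm_algMap_le f g t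

lemma map_tmul (f : A →⋆ₐ[ℂ] A') (g : B →⋆ₐ[ℂ] B') (a : A) (b : B) :
    map f g (tmul a b) = tmul (f a) (g b) := lift_coe _ _ (a ⊗ₜ b)

/-- `AssocRel x y` says that `x` and `y` correspond to each other under the canonical isomorphism
`(A ⊗ B) ⊗ C ≅ A ⊗ (B ⊗ C)`. The graph of this isometric isomorphism is the closure of its
restriction to the dense algebraic tensor products, that is, the closed linear span of the pairs
`((a ⊗ b) ⊗ c, a ⊗ (b ⊗ c))`. -/
def AssocRel {A B C : Type u} [CStarAlgebra A] [CStarAlgebra B] [CStarAlgebra C]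
    (x : MinTensor (MinTensor A B) C) (y : MinTensor A (MinTensor B C)) : Prop :=
  (x, y) ∈ closure (Submodule.span ℂ
    {p : MinTensor (MinTensor A B) C × MinTensor A (MinTensor B C) |
      ∃ a b c, p = (tmul (tmul a b) c, tmul a (tmul b c))} : Set _)

end MinTensor

end MinTensor

section FunctionAlgebras

set_option linter.unusedSectionVars false

variable (X Y Z : Type u) [TopologicalSpace X] [CompactSpace X] [T2Space X]
  [TopologicalSpace Y] [CompactSpace Y] [T2Space Y]
  [TopologicalSpace Z] [CompactSpace Z] [T2Space Z]

namespace MinTensor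

/-- The map `C(X) ⊗ C(Y) → C(X × Y)`, `f ⊗ g ↦ ((x, y) ↦ f x * g y)` on the algebraic tensor
product. -/
def algFun : C(X, ℂ) ⊗[ℂ] C(Y, ℂ) →⋆ₐ[ℂ] C(X × Y, ℂ) :=
  { Algebra.TensorProduct.productMap
      (ContinuousMap.compStarAlgHom' ℂ ℂ (ContinuousMap.fst : C(X × Y, X))).toAlgHom
      (ContinuousMap.compStarAlgHom' ℂ ℂ (ContinuousMap.snd : C(X × Y, Y))).toAlgHom with
    map_star' := fun t => by
      change Algebra.TensorProduct.productMap _ _ (star t) =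
        star (Algebra.TensorProduct.productMap _ _ t)
      induction t using TensorProduct.induction_on with
      | zero => simp
      | add s t hs ht => rw [star_add, map_add, map_add, hs, ht, star_add]
      | tmul a b =>
        ext p
        simp }

variable {X Y Z}

lemma algFun_tmul (f : C(X, ℂ)) (g : C(Y, ℂ)) (p : X × Y) :
    algFun X Y (f ⊗ₜ g) p = f p.1 * g p.2 := rfl

/-- Evaluation at a point, as a one-dimensional representation. -/
def evalRep (x : X) : C(X, ℂ) →⋆ₐ[ℂ]
    (EuclideanSpace ℂ PUnit.{u+1} →L[ℂ] EuclideanSpace ℂ PUnit.{u+1}) :=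
  (StarAlgHom.ofId ℂ _).comp (ContinuousMap.evalStarAlgHom ℂ ℂ x)

lemma evalRep_apply (x : X) (f : C(X, ℂ)) (v : EuclideanSpace ℂ PUnit.{u+1}) :
    evalRep x f v = f x • v := rfl

lemma algFun_norm_le (t : C(X, ℂ) ⊗[ℂ] C(Y, ℂ)) : ‖algFun X Y t‖ ≤ minNorm t := by
  rw [ContinuousMap.norm_le _ (minNorm_nonneg t)]
  intro p
  let e : EuclideanSpace ℂ PUnit.{u+1} := EuclideanSpace.single PUnit.unit 1
  have he : ‖e‖ = 1 := by simp [e]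
  have h : tensorRep (evalRep p.1) (evalRep p.2) t (e ⊗ₜ e) = algFun X Y t p • (e ⊗ₜ[ℂ] e) := by
    induction t using TensorProduct.induction_on with
    | zero => simp
    | add s t hs ht => rw [map_add, add_apply, hs, ht, map_add,
        ContinuousMap.add_apply, add_smul]
    | tmul a b =>
      rw [tensorRep_tmul, TensorProduct.mapL_tmul, algFun_tmul,
        evalRep_apply, evalRep_apply, TensorProduct.smul_tmul_smul]
  have h2 := (tensorRep (evalRep p.1) (evalRep p.2) t).le_opNorm (e ⊗ₜ e)
  rw [h, norm_smul, TensorProduct.norm_tmul, he, mul_one, mul_one, mul_one] at h2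
  exact h2.trans (le_minNorm _ _ t)

/-- The canonical map `C(X) ⊗ C(Y) → C(X × Y)` on the minimal tensor product. -/
def toFun : MinTensor C(X, ℂ) C(Y, ℂ) →⋆ₐ[ℂ] C(X × Y, ℂ) :=
  lift (algFun X Y) algFun_norm_le

lemma toFun_tmul (f : C(X, ℂ)) (g : C(Y, ℂ)) (p : X × Y) :
    toFun (tmul f g) p = f p.1 * g p.2 := by
  rw [toFun, tmul, coeHom_apply, lift_coe, algFun_tmul]

lemma exists_eval (χ : C(X, ℂ) →ₐ[ℂ] ℂ) : ∃ x, ∀ f, χ f = f x := by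
  obtain ⟨x, hx⟩ := (WeakDual.CharacterSpace.continuousMapEval_bijective (X := X) (𝕜 := ℂ)).2
    (WeakDual.CharacterSpace.equivAlgHom.symm χ)
  exact ⟨x, fun f => (congrArg (fun φ => φ f) hx).symm⟩

lemma tmul_mul {A B : Type u} [CStarAlgebra A] [CStarAlgebra B] (a a' : A) (b b' : B) :
    (tmul a b * tmul a' b' : MinTensor A B) = tmul (a * a') (b * b') := by
  rw [tmul, tmul, tmul, ← map_mul, Algebra.TensorProduct.tmul_mul_tmul]

lemma toFun_injective : Function.Injective (toFun (X := X) (Y := Y)) := by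
  have hcomm : ∀ x y : MinTensor C(X, ℂ) C(Y, ℂ), x * y = y * x := by
    intro x y
    induction x using MinTensor.induction with
    | hc => exact isClosed_eq (continuous_mul_const y) (continuous_const_mul y)
    | h s =>
      induction y using MinTensor.induction with
      | hc => exact isClosed_eq (continuous_const_mul _) (continuous_mul_const _)
      | h t => rw [← coe_mul, ← coe_mul, mul_comm]
  let _ : CommCStarAlgebra (MinTensor C(X, ℂ) C(Y, ℂ)) :=
    { (inferInstance : CStarAlgebra (MinTensor C(X, ℂ) C(Y, ℂ))) with mul_comm := hcomm }
  rw [injective_iff_map_eq_zero]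
  intro d hd
  apply (gelfandTransform_isometry (MinTensor C(X, ℂ) C(Y, ℂ))).injective
  rw [map_zero]
  ext χ
  let χ' : MinTensor C(X, ℂ) C(Y, ℂ) →ₐ[ℂ] ℂ := WeakDual.CharacterSpace.equivAlgHom χ
  obtain ⟨x, hx⟩ := exists_eval (χ'.comp
    ((coeHom : C(X, ℂ) ⊗[ℂ] C(Y, ℂ) →⋆ₐ[ℂ] _).toAlgHom.comp Algebra.TensorProduct.includeLeft))
  obtain ⟨y, hy⟩ := exists_eval (χ'.comp
    ((coeHom : C(X, ℂ) ⊗[ℂ] C(Y, ℂ) →⋆ₐ[ℂ] _).toAlgHom.comp Algebra.TensorProduct.includeRight))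
  have h : χ' d = toFun d (x, y) := by
    refine ext_tmul (f := χ'.toLinearMap)
      (g := ((ContinuousMap.evalStarAlgHom ℂ ℂ (x, y)).comp toFun).toAlgHom.toLinearMap)
      (map_continuous χ) (continuous_starAlgHom ((ContinuousMap.evalStarAlgHom ℂ ℂ (x, y)).comp toFun))
      (fun a b => ?_) d
    have h1 : (tmul a b : MinTensor C(X, ℂ) C(Y, ℂ)) = tmul a 1 * tmul 1 b := by
      rw [tmul_mul, mul_one, one_mul]
    change χ' (tmul a b) = toFun (tmul a b) (x, y)
    rw [toFun_tmul, h1, map_mul]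
    exact congrArg₂ (· * ·) (hx a) (hy b)
  change χ' d = 0
  rw [h, hd]
  rfl

lemma toFun_isometry : Isometry (toFun (X := X) (Y := Y)) :=
  NonUnitalStarAlgHom.isometry toFun toFun_injective

lemma toFun_surjective : Function.Surjective (toFun (X := X) (Y := Y)) := by
  have hclosed : IsClosed ((toFun (X := X) (Y := Y)).range : Set C(X × Y, ℂ)) := by
    have := (toFun_isometry (X := X) (Y := Y)).isClosedEmbedding.isClosed_range
    have h : ((toFun (X := X) (Y := Y)).range : Set C(X × Y, ℂ)) =
        Set.range (toFun (X := X) (Y := Y)) := by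
      ext F
      rfl
    rwa [h]
  have hsep : (toFun (X := X) (Y := Y)).range.SeparatesPoints := by
    have key : ∀ {W : Type u} [TopologicalSpace W] [CompactSpace W] [T2Space W] (a b : W),
        a ≠ b → ∃ f : C(W, ℂ), f a ≠ f b := by
      intro W _ _ _ a b hab
      obtain ⟨f, ha, hb, -⟩ := exists_continuous_zero_one_of_isClosed (isClosed_singleton (x := a))
        (isClosed_singleton (x := b)) (Set.disjoint_singleton.mpr hab)
      refine ⟨⟨fun w => (f w : ℂ), Complex.continuous_ofReal.comp f.continuous⟩, ?_⟩
      have ha' : f a = 0 := ha rfl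
      have hb' : f b = 1 := hb rfl
      simp [ha', hb']
    intro p q hpq
    by_cases h : p.1 = q.1
    · have h2 : p.2 ≠ q.2 := fun h2 => hpq (Prod.ext h h2)
      obtain ⟨f, hf⟩ := key _ _ h2
      refine ⟨toFun (tmul 1 f), ⟨_, ⟨tmul 1 f, rfl⟩, rfl⟩, ?_⟩
      rw [toFun_tmul, toFun_tmul]
      simpa using hf
    · obtain ⟨f, hf⟩ := key _ _ h
      refine ⟨toFun (tmul f 1), ⟨_, ⟨tmul f 1, rfl⟩, rfl⟩, ?_⟩
      rw [toFun_tmul, toFun_tmul]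
      simpa using hf
  have htop := ContinuousMap.starSubalgebra_topologicalClosure_eq_top_of_separatesPoints
    (toFun (X := X) (Y := Y)).range hsep
  intro F
  have hF : F ∈ (toFun (X := X) (Y := Y)).range.topologicalClosure := htop ▸ trivial
  rw [← SetLike.mem_coe, StarSubalgebra.topologicalClosure_coe, hclosed.closure_eq] at hF
  exact hF

/-- The isomorphism `C(X) ⊗ C(Y) ≅ C(X × Y)`. -/
def funEquiv : MinTensor C(X, ℂ) C(Y, ℂ) ≃⋆ₐ[ℂ] C(X × Y, ℂ) :=
  StarAlgEquiv.ofBijective toFun ⟨toFun_injective, toFun_surjective⟩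

/-- The inverse of `C(X) ⊗ C(Y) ≅ C(X × Y)`. -/
def ofFun : C(X × Y, ℂ) →⋆ₐ[ℂ] MinTensor C(X, ℂ) C(Y, ℂ) :=
  ((funEquiv (X := X) (Y := Y)).symm : C(X × Y, ℂ) →⋆ₐ[ℂ] MinTensor C(X, ℂ) C(Y, ℂ))

lemma toFun_ofFun (F : C(X × Y, ℂ)) : toFun (ofFun F) = F :=
  (funEquiv (X := X) (Y := Y)).apply_symm_apply F

lemma ofFun_toFun (x : MinTensor C(X, ℂ) C(Y, ℂ)) : ofFun (toFun x) = x :=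
  (funEquiv (X := X) (Y := Y)).symm_apply_apply x

lemma continuous_tmul_left {A B : Type u} [CStarAlgebra A] [CStarAlgebra B] (b : B) :
    Continuous fun a : A => (tmul a b : MinTensor A B) := by
  let i : A →⋆ₐ[ℂ] MinTensor A B :=
    { (coeHom : A ⊗[ℂ] B →⋆ₐ[ℂ] _).toAlgHom.comp Algebra.TensorProduct.includeLeft with
      map_star' := fun a => by
        change coeHom (star a ⊗ₜ (1 : B)) = star (coeHom (a ⊗ₜ (1 : B)))
        rw [← map_star, TensorProduct.star_tmul, star_one] }
  have h : (fun a : A => (tmul a b : MinTensor A B)) = fun a => i a * tmul 1 b := by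
    funext a
    change _ = tmul a 1 * tmul 1 b
    rw [tmul_mul, mul_one, one_mul]
  rw [h]
  exact (continuous_mul_const _).comp (continuous_starAlgHom i)

lemma assocRel_of_hom {A B C : Type u} [CStarAlgebra A] [CStarAlgebra B] [CStarAlgebra C]
    (α : MinTensor (MinTensor A B) C →⋆ₐ[ℂ] MinTensor A (MinTensor B C))
    (h : ∀ a b c, α (tmul (tmul a b) c) = tmul a (tmul b c)) (x : MinTensor (MinTensor A B) C) :
    AssocRel x (α x) := by
  let S := (Submodule.span ℂ {p : MinTensor (MinTensor A B) C × MinTensor A (MinTensor B C) |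
      ∃ a b c, p = (tmul (tmul a b) c, tmul a (tmul b c))}).topologicalClosure
  have hS : IsClosed (S : Set (MinTensor (MinTensor A B) C × MinTensor A (MinTensor B C))) :=
    isClosed_closure
  let g : MinTensor (MinTensor A B) C →ₗ[ℂ]
      MinTensor (MinTensor A B) C × MinTensor A (MinTensor B C) :=
    LinearMap.prod LinearMap.id α.toAlgHom.toLinearMap
  have hg : Continuous g := continuous_id.prodMk (continuous_starAlgHom α)
  have h1 : ∀ (w : MinTensor A B) (c : C), tmul w c ∈ S.comap g := by
    intro w c
    let k : MinTensor A B →ₗ[ℂ] MinTensor (MinTensor A B) C :=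
      (coeHom : MinTensor A B ⊗[ℂ] C →⋆ₐ[ℂ] _).toAlgHom.toLinearMap ∘ₗ
        (TensorProduct.mk ℂ (MinTensor A B) C).flip c
    have hk : Continuous k := continuous_tmul_left c
    have hle : Submodule.span ℂ {x : MinTensor A B | ∃ a b, x = tmul a b} ≤ S.comap (g ∘ₗ k) := by
      rw [Submodule.span_le]
      rintro _ ⟨a, b, rfl⟩
      refine Submodule.le_topologicalClosure _ (Submodule.subset_span ⟨a, b, c, ?_⟩)
      exact Prod.ext rfl (h a b c)
    have hcl : IsClosed ((S.comap (g ∘ₗ k) : Submodule ℂ (MinTensor A B)) : Set (MinTensor A B)) :=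
      hS.preimage (hg.comp hk)
    exact hcl.closure_subset_iff.mpr hle (span_tmul_dense w)
  have hle : Submodule.span ℂ {x : MinTensor (MinTensor A B) C | ∃ a b, x = tmul a b} ≤
      S.comap g := by
    rw [Submodule.span_le]
    rintro _ ⟨w, c, rfl⟩
    exact h1 w c
  have hcl : IsClosed ((S.comap g : Submodule ℂ _) : Set (MinTensor (MinTensor A B) C)) :=
    hS.preimage hg
  exact hcl.closure_subset_iff.mpr hle (span_tmul_dense x)

/-- `(C(X) ⊗ C(Y)) ⊗ C(Z) → C(X × Y × Z)`. -/
def tripleLeft : MinTensor (MinTensor C(X, ℂ) C(Y, ℂ)) C(Z, ℂ) →⋆ₐ[ℂ] C(X × (Y × Z), ℂ) :=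
  (ContinuousMap.compStarAlgHom' ℂ ℂ
    ((Homeomorph.prodAssoc X Y Z).symm : C(X × (Y × Z), (X × Y) × Z))).comp
    (toFun.comp (map toFun (StarAlgHom.id ℂ _)))

/-- `C(X) ⊗ (C(Y) ⊗ C(Z)) → C(X × Y × Z)`. -/
def tripleRight : MinTensor C(X, ℂ) (MinTensor C(Y, ℂ) C(Z, ℂ)) →⋆ₐ[ℂ] C(X × (Y × Z), ℂ) :=
  toFun.comp (map (StarAlgHom.id ℂ _) toFun)

/-- The inverse of `tripleRight`. -/
def tripleRightInv : C(X × (Y × Z), ℂ) →⋆ₐ[ℂ] MinTensor C(X, ℂ) (MinTensor C(Y, ℂ) C(Z, ℂ)) :=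
  (map (StarAlgHom.id ℂ _) ofFun).comp ofFun

lemma map_id_ofFun_toFun (y : MinTensor C(X, ℂ) (MinTensor C(Y, ℂ) C(Z, ℂ))) :
    map (StarAlgHom.id ℂ C(X, ℂ)) (ofFun (X := Y) (Y := Z))
      (map (StarAlgHom.id ℂ C(X, ℂ)) (toFun (X := Y) (Y := Z)) y) = y := by
  have h : (map (StarAlgHom.id ℂ C(X, ℂ)) (ofFun (X := Y) (Y := Z))).comp
      (map (StarAlgHom.id ℂ C(X, ℂ)) (toFun (X := Y) (Y := Z))) = StarAlgHom.id ℂ _ := by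
    refine ext fun a b => ?_
    rw [StarAlgHom.comp_apply, map_tmul, map_tmul, ofFun_toFun]
    rfl
  exact DFunLike.congr_fun h y

lemma tripleRightInv_tripleRight (y : MinTensor C(X, ℂ) (MinTensor C(Y, ℂ) C(Z, ℂ))) :
    tripleRightInv (tripleRight y) = y := by
  rw [tripleRightInv, tripleRight, StarAlgHom.comp_apply, StarAlgHom.comp_apply, ofFun_toFun]
  exact map_id_ofFun_toFun y

lemma tripleLeft_tmul (a : C(X, ℂ)) (b : C(Y, ℂ)) (c : C(Z, ℂ)) (p : X) (q : Y) (r : Z) :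
    tripleLeft (tmul (tmul a b) c) (p, (q, r)) = a p * b q * c r := by
  change toFun (map toFun (StarAlgHom.id ℂ _) (tmul (tmul a b) c)) ((p, q), r) = _
  rw [map_tmul, toFun_tmul, toFun_tmul]
  rfl

lemma tripleRight_tmul (a : C(X, ℂ)) (b : C(Y, ℂ)) (c : C(Z, ℂ)) (p : X) (q : Y) (r : Z) :
    tripleRight (tmul a (tmul b c)) (p, (q, r)) = a p * b q * c r := by
  change toFun (map (StarAlgHom.id ℂ _) toFun (tmul a (tmul b c))) (p, (q, r)) = _
  rw [map_tmul, toFun_tmul, toFun_tmul, ← mul_assoc]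
  rfl

lemma assocRel_of_eq {x : MinTensor (MinTensor C(X, ℂ) C(Y, ℂ)) C(Z, ℂ)}
    {y : MinTensor C(X, ℂ) (MinTensor C(Y, ℂ) C(Z, ℂ))} (h : tripleLeft x = tripleRight y) :
    AssocRel x y := by
  have hα := assocRel_of_hom (tripleRightInv.comp (tripleLeft (X := X) (Y := Y) (Z := Z)))
    (fun a b c => ?_) x
  · rw [StarAlgHom.comp_apply, h, tripleRightInv_tripleRight] at hα
    exact hα
  · have h2 : tripleLeft (tmul (tmul a b) c) = tripleRight (tmul a (tmul b c)) := by
      ext ⟨p, q, r⟩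
      rw [tripleLeft_tmul, tripleRight_tmul]
    rw [StarAlgHom.comp_apply, h2, tripleRightInv_tripleRight]

end MinTensor
end FunctionAlgebras

/-- A compact quantum group: a unital `C*`-algebra `A` with a unital `*`-homomorphism
`Δ : A → A ⊗ A` (minimal tensor product) which is coassociative and satisfies the cancellation
conditions: `Δ(A)(1 ⊗ A)` and `Δ(A)(A ⊗ 1)` have dense linear span in `A ⊗ A`. -/
structure CStarQG : Type (u + 1) where
  carrier : Type u
  [cstar : CStarAlgebra carrier]
  comul : carrier →⋆ₐ[ℂ] MinTensor carrier carrier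
  coassoc : ∀ a, MinTensor.AssocRel
    (MinTensor.map comul (StarAlgHom.id ℂ carrier) (comul a))
    (MinTensor.map (StarAlgHom.id ℂ carrier) comul (comul a))
  dense_right : Dense (Submodule.span ℂ
    {x : MinTensor carrier carrier | ∃ a b, x = comul a * MinTensor.tmul 1 b} :
      Set (MinTensor carrier carrier))
  dense_left : Dense (Submodule.span ℂ
    {x : MinTensor carrier carrier | ∃ a b, x = comul a * MinTensor.tmul b 1} :
      Set (MinTensor carrier carrier))

namespace CStarQG

attribute [instance] CStarQG.cstar

instance : CoeSort CStarQG.{u} (Type u) := ⟨CStarQG.carrier⟩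

/-- Morphisms: unital `*`-homomorphisms `f` with `(f ⊗ f) ∘ Δ = Δ ∘ f`. -/
@[ext]
structure Hom (A B : CStarQG.{u}) where
  hom : A →⋆ₐ[ℂ] B
  map_comul : ∀ a, MinTensor.map hom hom (A.comul a) = B.comul (hom a)

instance : Category CStarQG.{u} where
  Hom := Hom
  id A := ⟨StarAlgHom.id ℂ A, fun a =>
    DFunLike.congr_fun (f := MinTensor.map (StarAlgHom.id ℂ A) (StarAlgHom.id ℂ A))
      (g := StarAlgHom.id ℂ _) (MinTensor.ext fun a b => MinTensor.map_tmul _ _ a b) (A.comul a)⟩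
  comp {A B C} f g := ⟨g.hom.comp f.hom, fun a => by
    have h : MinTensor.map (g.hom.comp f.hom) (g.hom.comp f.hom) =
        (MinTensor.map g.hom g.hom).comp (MinTensor.map f.hom f.hom) :=
      MinTensor.ext fun a b => by
        rw [StarAlgHom.comp_apply, MinTensor.map_tmul, MinTensor.map_tmul, MinTensor.map_tmul]
        rfl
    rw [h, StarAlgHom.comp_apply, f.map_comul, g.map_comul, StarAlgHom.comp_apply]⟩

/-- The commutative compact quantum groups. -/
def isCommutative : ObjectProperty CStarQG.{u} := fun A => ∀ a b : A, a * b = b * a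

end CStarQG

/-- `π : A → B` exhibits `B` as the largest commutative quotient `C*`-algebra of `A`. -/
def IsLargestCommQuotientCStar {A B : Type u} [CStarAlgebra A] [CStarAlgebra B]
    (π : A →⋆ₐ[ℂ] B) : Prop :=
  Function.Surjective π ∧ (∀ x y : B, x * y = y * x) ∧
    ∀ (C : Type u) [CommCStarAlgebra C] (f : A →⋆ₐ[ℂ] C), ∃! g : B →⋆ₐ[ℂ] C, g.comp π = f

/-- A compact Hausdorff topological group. -/
structure CompGrp : Type (u + 1) where
  carrier : Type u
  [group : Group carrier]
  [topology : TopologicalSpace carrier]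
  [topGroup : IsTopologicalGroup carrier]
  [compact : CompactSpace carrier]
  [hausdorff : T2Space carrier]

namespace CompGrp

attribute [instance] group topology topGroup compact hausdorff

instance : CoeSort CompGrp.{u} (Type u) := ⟨CompGrp.carrier⟩

/-- Morphisms of compact groups are the continuous group homomorphisms. -/
@[ext]
structure Hom (G H : CompGrp.{u}) where
  hom : G →ₜ* H

instance : Category CompGrp.{u} where
  Hom := Hom
  id G := ⟨ContinuousMonoidHom.id G⟩
  comp f g := ⟨g.hom.comp f.hom⟩

end CompGrp

section ContinuousFunctions

set_option linter.unusedSectionVars false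

variable (G : Type u) [Group G] [TopologicalSpace G] [IsTopologicalGroup G] [CompactSpace G]
  [T2Space G]

/-- The comultiplication `(Δ f)(g, h) = f (g h)` of `C(G)`, with `C(G × G) ≅ C(G) ⊗ C(G)`. -/
def contComul : C(G, ℂ) →⋆ₐ[ℂ] MinTensor C(G, ℂ) C(G, ℂ) :=
  MinTensor.ofFun.comp
    (ContinuousMap.compStarAlgHom' ℂ ℂ (⟨fun p => p.1 * p.2, continuous_mul⟩ : C(G × G, G)))

variable {G}

lemma toFun_contComul (f : C(G, ℂ)) (p : G × G) :
    MinTensor.toFun (contComul G f) p = f (p.1 * p.2) := by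
  rw [contComul, StarAlgHom.comp_apply, MinTensor.toFun_ofFun]
  rfl

lemma tripleLeft_contComul (x : MinTensor C(G, ℂ) C(G, ℂ)) (p q r : G) :
    MinTensor.tripleLeft (MinTensor.map (contComul G) (StarAlgHom.id ℂ _) x) (p, (q, r)) =
      MinTensor.toFun x (p * q, r) := by
  have h : ((ContinuousMap.evalStarAlgHom ℂ ℂ (p, (q, r))).comp MinTensor.tripleLeft).comp
      (MinTensor.map (contComul G) (StarAlgHom.id ℂ C(G, ℂ))) =
      (ContinuousMap.evalStarAlgHom ℂ ℂ (p * q, r)).comp MinTensor.toFun := by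
    refine MinTensor.ext fun a b => ?_
    rw [StarAlgHom.comp_apply, MinTensor.map_tmul]
    change MinTensor.toFun (MinTensor.map MinTensor.toFun (StarAlgHom.id ℂ _)
      (MinTensor.tmul (contComul G a) b)) ((p, q), r) =
      MinTensor.toFun (MinTensor.tmul a b) (p * q, r)
    rw [MinTensor.map_tmul, MinTensor.toFun_tmul, MinTensor.toFun_tmul, toFun_contComul]
    rfl
  exact DFunLike.congr_fun h x

lemma tripleRight_contComul (x : MinTensor C(G, ℂ) C(G, ℂ)) (p q r : G) :
    MinTensor.tripleRight (MinTensor.map (StarAlgHom.id ℂ _) (contComul G) x) (p, (q, r)) =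
      MinTensor.toFun x (p, q * r) := by
  have h : ((ContinuousMap.evalStarAlgHom ℂ ℂ (p, (q, r))).comp MinTensor.tripleRight).comp
      (MinTensor.map (StarAlgHom.id ℂ C(G, ℂ)) (contComul G)) =
      (ContinuousMap.evalStarAlgHom ℂ ℂ (p, q * r)).comp MinTensor.toFun := by
    refine MinTensor.ext fun a b => ?_
    rw [StarAlgHom.comp_apply, MinTensor.map_tmul]
    change MinTensor.toFun (MinTensor.map (StarAlgHom.id ℂ _) MinTensor.toFun
      (MinTensor.tmul a (contComul G b))) (p, (q, r)) =
      MinTensor.toFun (MinTensor.tmul a b) (p, q * r)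
    rw [MinTensor.map_tmul, MinTensor.toFun_tmul, MinTensor.toFun_tmul, toFun_contComul]
    rfl
  exact DFunLike.congr_fun h x

lemma dense_of_shear (s : (G × G) ≃ₜ (G × G)) (S : Set (MinTensor C(G, ℂ) C(G, ℂ)))
    (hS : ∀ a b : C(G, ℂ), MinTensor.ofFun (ContinuousMap.compStarAlgHom' ℂ ℂ (s : C(G × G, G × G))
      (MinTensor.toFun (MinTensor.tmul a b))) ∈ S) :
    Dense (Submodule.span ℂ S : Set (MinTensor C(G, ℂ) C(G, ℂ))) := by
  let Ψ : MinTensor C(G, ℂ) C(G, ℂ) →⋆ₐ[ℂ] MinTensor C(G, ℂ) C(G, ℂ) :=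
    MinTensor.ofFun.comp ((ContinuousMap.compStarAlgHom' ℂ ℂ (s : C(G × G, G × G))).comp
      MinTensor.toFun)
  have hΨ : Function.Surjective Ψ := by
    intro y
    refine ⟨MinTensor.ofFun (ContinuousMap.compStarAlgHom' ℂ ℂ (s.symm : C(G × G, G × G))
      (MinTensor.toFun y)), ?_⟩
    change MinTensor.ofFun (ContinuousMap.compStarAlgHom' ℂ ℂ (s : C(G × G, G × G))
      (MinTensor.toFun (MinTensor.ofFun _))) = y
    rw [MinTensor.toFun_ofFun]
    have : ContinuousMap.compStarAlgHom' ℂ ℂ (s : C(G × G, G × G))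
        (ContinuousMap.compStarAlgHom' ℂ ℂ (s.symm : C(G × G, G × G)) (MinTensor.toFun y)) =
        MinTensor.toFun y := by
      ext p
      simp
    rw [this, MinTensor.ofFun_toFun]
  refine (hΨ.denseRange.dense_image (MinTensor.continuous_starAlgHom Ψ)
    MinTensor.span_tmul_dense).mono ?_
  rintro _ ⟨x, hx, rfl⟩
  have hle : Submodule.span ℂ {x : MinTensor C(G, ℂ) C(G, ℂ) | ∃ a b, x = MinTensor.tmul a b} ≤
      (Submodule.span ℂ S).comap Ψ.toAlgHom.toLinearMap := by
    rw [Submodule.span_le]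
    rintro _ ⟨a, b, rfl⟩
    exact Submodule.subset_span (hS a b)
  exact hle hx

/-- The compact quantum group `C(G)` of continuous functions on a compact group. -/
def contObj (G : CompGrp.{u}) : CStarQG.{u} where
  carrier := C(G, ℂ)
  comul := contComul G
  coassoc f := by
    refine MinTensor.assocRel_of_eq (ContinuousMap.ext fun ⟨p, q, r⟩ => ?_)
    rw [tripleLeft_contComul, tripleRight_contComul, toFun_contComul, toFun_contComul, mul_assoc]
  dense_right := by
    let s : G × G ≃ₜ G × G :=
      { toFun := fun p => (p.1 * p.2, p.2)
        invFun := fun p => (p.1 * p.2⁻¹, p.2)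
        left_inv := fun p => by simp
        right_inv := fun p => by simp
        continuous_toFun := by fun_prop
        continuous_invFun := by fun_prop }
    refine dense_of_shear s _ fun a b => ⟨a, b, ?_⟩
    apply MinTensor.toFun_injective
    ext p
    rw [MinTensor.toFun_ofFun, map_mul, ContinuousMap.mul_apply, toFun_contComul,
      MinTensor.toFun_tmul]
    change MinTensor.toFun (MinTensor.tmul a b) (p.1 * p.2, p.2) = _
    rw [MinTensor.toFun_tmul]
    simp
  dense_left := by
    let s : G × G ≃ₜ G × G :=
      { toFun := fun p => (p.1 * p.2, p.1)
        invFun := fun p => (p.2, p.2⁻¹ * p.1)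
        left_inv := fun p => by simp
        right_inv := fun p => by simp
        continuous_toFun := by fun_prop
        continuous_invFun := by fun_prop }
    refine dense_of_shear s _ fun a b => ⟨a, b, ?_⟩
    apply MinTensor.toFun_injective
    ext p
    rw [MinTensor.toFun_ofFun, map_mul, ContinuousMap.mul_apply, toFun_contComul,
      MinTensor.toFun_tmul]
    change MinTensor.toFun (MinTensor.tmul a b) (p.1 * p.2, p.1) = _
    rw [MinTensor.toFun_tmul]
    simp

lemma map_contComul {H : Type u} [Group H] [TopologicalSpace H] [IsTopologicalGroup H]
    [CompactSpace H] [T2Space H] (φ : H →ₜ* G) (f : C(G, ℂ)) :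
    MinTensor.map (ContinuousMap.compStarAlgHom' ℂ ℂ (φ : C(H, G)))
      (ContinuousMap.compStarAlgHom' ℂ ℂ (φ : C(H, G))) (contComul G f) =
      contComul H (f.comp (φ : C(H, G))) := by
  apply MinTensor.toFun_injective
  ext p
  have h : ((ContinuousMap.evalStarAlgHom ℂ ℂ p).comp MinTensor.toFun).comp
      (MinTensor.map (ContinuousMap.compStarAlgHom' ℂ ℂ (φ : C(H, G)))
        (ContinuousMap.compStarAlgHom' ℂ ℂ (φ : C(H, G)))) =
      (ContinuousMap.evalStarAlgHom ℂ ℂ (φ p.1, φ p.2)).comp MinTensor.toFun := by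
    refine MinTensor.ext fun a b => ?_
    rw [StarAlgHom.comp_apply, MinTensor.map_tmul]
    change MinTensor.toFun (MinTensor.tmul _ _) p = MinTensor.toFun (MinTensor.tmul a b) _
    rw [MinTensor.toFun_tmul, MinTensor.toFun_tmul]
    rfl
  refine (DFunLike.congr_fun h (contComul G f)).trans ?_
  change MinTensor.toFun (contComul G f) (φ p.1, φ p.2) = _
  rw [toFun_contComul, toFun_contComul, ← map_mul]
  rfl

/-- The contravariant functor `G ↦ C(G)`, `φ ↦ (f ↦ f ∘ φ)`. -/
def contFunctor : CompGrp.{u}ᵒᵖ ⥤ CStarQG.{u} where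
  obj G := contObj G.unop
  map {G H} φ :=
    { hom := ContinuousMap.compStarAlgHom' ℂ ℂ (φ.unop.hom : C(H.unop, G.unop))
      map_comul := fun f => map_contComul φ.unop.hom f }
  map_id _ := rfl
  map_comp _ _ := rfl

end ContinuousFunctions

section RepresentativeFunctions

open Algebra.TensorProduct

lemma tensor_separating {A B I J : Type*} [CommRing A] [Algebra ℂ A] [CommRing B] [Algebra ℂ B]
    (φ : I → A →ₐ[ℂ] ℂ) (ψ : J → B →ₐ[ℂ] ℂ) (hφ : ∀ a, (∀ i, φ i a = 0) → a = 0)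
    (hψ : ∀ b, (∀ j, ψ j b = 0) → b = 0) (t : A ⊗[ℂ] B)
    (ht : ∀ i j, productMap (φ i) (ψ j) t = 0) : t = 0 := by
  classical
  let 𝒞 := Module.Basis.ofVectorSpace ℂ B
  have h1 : ∀ i, TensorProduct.lid ℂ B ((φ i).toLinearMap.rTensor B t) = 0 := by
    intro i
    apply hψ
    intro j
    rw [← ht i j]
    have : (ψ j).toLinearMap ∘ₗ (TensorProduct.lid ℂ B).toLinearMap ∘ₗ
        (φ i).toLinearMap.rTensor B = (productMap (φ i) (ψ j)).toLinearMap := by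
      ext a b
      simp
    exact LinearMap.congr_fun this t
  apply (TensorProduct.equivFinsuppOfBasisRight (M := A) 𝒞).injective
  rw [map_zero]
  ext k
  apply hφ
  intro i
  have h2 : (φ i).toLinearMap ∘ₗ Finsupp.lapply k ∘ₗ
      (TensorProduct.equivFinsuppOfBasisRight (M := A) 𝒞).toLinearMap =
      Finsupp.lapply k ∘ₗ 𝒞.repr.toLinearMap ∘ₗ (TensorProduct.lid ℂ B).toLinearMap ∘ₗ
        (φ i).toLinearMap.rTensor B := by
    ext a b
    simp [mul_comm]
  have h3 := LinearMap.congr_fun h2 t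
  change φ i ((TensorProduct.equivFinsuppOfBasisRight (M := A) 𝒞 t) k) =
    𝒞.repr (TensorProduct.lid ℂ B ((φ i).toLinearMap.rTensor B t)) k at h3
  rw [h3, h1, map_zero]
  rfl

variable (G : Type u) [Group G] [TopologicalSpace G]

/-- The matrix coefficients of the finite-dimensional continuous unitary representations. -/
def repCoeffs : Set C(G, ℂ) :=
  {f | ∃ (ι : Type) (_ : Fintype ι) (_ : DecidableEq ι) (ρ : G →ₜ* Matrix.unitaryGroup ι ℂ)
    (i j : ι), ∀ g, f g = (ρ g : Matrix ι ι ℂ) i j}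

variable {G}

/-- A matrix coefficient of a unitary representation, as a continuous function. -/
def repCoeff {ι : Type} [Fintype ι] [DecidableEq ι] (ρ : G →ₜ* Matrix.unitaryGroup ι ℂ)
    (i j : ι) : C(G, ℂ) :=
  ⟨fun g => (ρ g : Matrix ι ι ℂ) i j,
    (continuous_subtype_val.comp (map_continuous ρ)).matrix_elem i j⟩

lemma repCoeff_mem {ι : Type} [Fintype ι] [DecidableEq ι] (ρ : G →ₜ* Matrix.unitaryGroup ι ℂ)
    (i j : ι) : repCoeff ρ i j ∈ repCoeffs G :=
  ⟨ι, _, _, ρ, i, j, fun _ => rfl⟩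

lemma one_mem_repCoeffs : (1 : C(G, ℂ)) ∈ repCoeffs G :=
  ⟨Unit, _, _, 1, (), (), fun g => by simp⟩

lemma mul_mem_repCoeffs {f f' : C(G, ℂ)} (hf : f ∈ repCoeffs G) (hf' : f' ∈ repCoeffs G) :
    f * f' ∈ repCoeffs G := by
  obtain ⟨ι, _, _, ρ, i, j, h⟩ := hf
  obtain ⟨ι', _, _, ρ', i', j', h'⟩ := hf'
  refine ⟨ι × ι', inferInstance, inferInstance,
    { toFun := fun g => ⟨Matrix.kronecker (ρ g : Matrix ι ι ℂ) (ρ' g : Matrix ι' ι' ℂ),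
        Matrix.kronecker_mem_unitary (ρ g).2 (ρ' g).2⟩
      map_one' := Subtype.ext (by simp)
      map_mul' := fun g k => Subtype.ext (by simp [Matrix.mul_kronecker_mul])
      continuous_toFun := by
        refine Continuous.subtype_mk (continuous_matrix fun a b => ?_) _
        exact ((continuous_subtype_val.comp (map_continuous ρ)).matrix_elem _ _).mul
          ((continuous_subtype_val.comp (map_continuous ρ')).matrix_elem _ _) },
    (i, i'), (j, j'), fun g => ?_⟩
  rw [ContinuousMap.mul_apply, h, h']
  rfl

lemma star_mem_repCoeffs {f : C(G, ℂ)} (hf : f ∈ repCoeffs G) : star f ∈ repCoeffs G := by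
  obtain ⟨ι, _, _, ρ, i, j, h⟩ := hf
  refine ⟨ι, inferInstance, inferInstance,
    { toFun := fun g => ⟨(ρ g : Matrix ι ι ℂ).map star,
        Matrix.map_star_mem_unitaryGroup_iff.mpr (ρ g).2⟩
      map_one' := Subtype.ext (by simp)
      map_mul' := fun g k => Subtype.ext (by
        ext a b
        simp [Matrix.mul_apply])
      continuous_toFun := by
        refine Continuous.subtype_mk (continuous_matrix fun a b => ?_) _
        exact continuous_star.comp
          ((continuous_subtype_val.comp (map_continuous ρ)).matrix_elem _ _) },
    i, j, fun g => ?_⟩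
  rw [ContinuousMap.star_apply, h]
  rfl

lemma span_repCoeffs_mul {f f' : C(G, ℂ)} (hf : f ∈ Submodule.span ℂ (repCoeffs G))
    (hf' : f' ∈ Submodule.span ℂ (repCoeffs G)) : f * f' ∈ Submodule.span ℂ (repCoeffs G) := by
  have h := Submodule.mul_mem_mul hf hf'
  rw [Submodule.span_mul_span] at h
  refine Submodule.span_mono ?_ h
  rintro _ ⟨a, ha, b, hb, rfl⟩
  exact mul_mem_repCoeffs ha hb

variable (G)

/-- The `*`-algebra `O(G)` of representative functions: the linear span of the matrix
coefficients of the finite-dimensional continuous unitary representations of `G`. -/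
def repAlg : StarSubalgebra ℂ C(G, ℂ) where
  carrier := Submodule.span ℂ (repCoeffs G)
  mul_mem' := span_repCoeffs_mul
  add_mem' := Submodule.add_mem _
  algebraMap_mem' c := by
    rw [Algebra.algebraMap_eq_smul_one]
    exact Submodule.smul_mem _ _ (Submodule.subset_span one_mem_repCoeffs)
  star_mem' {f} hf := by
    change f ∈ Submodule.span ℂ (repCoeffs G) at hf
    change star f ∈ Submodule.span ℂ (repCoeffs G)
    induction hf using Submodule.span_induction with
    | mem f hf => exact Submodule.subset_span (star_mem_repCoeffs hf)
    | zero => rw [star_zero]; exact Submodule.zero_mem _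
    | add f f' _ _ hf hf' => rw [star_add]; exact Submodule.add_mem _ hf hf'
    | smul c f _ hf => rw [star_smul]; exact Submodule.smul_mem _ _ hf

variable {G}

lemma mem_repAlg {f : C(G, ℂ)} : f ∈ repAlg G ↔ f ∈ Submodule.span ℂ (repCoeffs G) := Iff.rfl

lemma repAlg_le {p : C(G, ℂ) → Prop} (h0 : p 0) (hadd : ∀ f f', p f → p f' → p (f + f'))
    (hsmul : ∀ (c : ℂ) f, p f → p (c • f))
    (h : ∀ {ι : Type} [Fintype ι] [DecidableEq ι] (ρ : G →ₜ* Matrix.unitaryGroup ι ℂ) (i j : ι),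
      p (repCoeff ρ i j)) {f : C(G, ℂ)} (hf : f ∈ repAlg G) : p f := by
  rw [mem_repAlg] at hf
  induction hf using Submodule.span_induction with
  | mem f hf =>
    obtain ⟨ι, _, _, ρ, i, j, hf⟩ := hf
    rw [show f = repCoeff ρ i j from ContinuousMap.ext hf]
    exact h ρ i j
  | zero => exact h0
  | add f f' _ _ hf hf' => exact hadd _ _ hf hf'
  | smul c f _ hf => exact hsmul _ _ hf

variable (G) in
/-- The `*`-algebra `O(G)` of representative functions, as a type. -/
def RepFun : Type u := repAlg G

instance : CommRing (RepFun G) := inferInstanceAs (CommRing (repAlg G))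
instance : Algebra ℂ (RepFun G) := inferInstanceAs (Algebra ℂ (repAlg G))
instance : StarRing (RepFun G) := inferInstanceAs (StarRing (repAlg G))
instance : StarModule ℂ (RepFun G) := inferInstanceAs (StarModule ℂ (repAlg G))

/-- A matrix coefficient, as an element of `O(G)`. -/
def repElt {ι : Type} [Fintype ι] [DecidableEq ι] (ρ : G →ₜ* Matrix.unitaryGroup ι ℂ)
    (i j : ι) : RepFun G := ⟨repCoeff ρ i j, Submodule.subset_span (repCoeff_mem ρ i j)⟩

/-- Evaluation at a point. -/
def repEval (g : G) : RepFun G →ₐ[ℂ] ℂ :=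
  ((ContinuousMap.evalStarAlgHom ℂ ℂ g).comp (repAlg G).subtype).toAlgHom

lemma repEval_apply (g : G) (f : RepFun G) : repEval g f = f.1 g := rfl

lemma repEval_separating (f : RepFun G) (h : ∀ g, repEval g f = 0) : f = 0 :=
  Subtype.ext (ContinuousMap.ext h)

/-- Evaluation of a two-variable representative function. -/
def repEval₂ (g h : G) : RepFun G ⊗[ℂ] RepFun G →ₐ[ℂ] ℂ := productMap (repEval g) (repEval h)

lemma repEval₂_separating (t : RepFun G ⊗[ℂ] RepFun G) (h : ∀ g k, repEval₂ g k t = 0) : t = 0 :=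
  tensor_separating repEval repEval repEval_separating repEval_separating t h

lemma repEval₂_ext {s t : RepFun G ⊗[ℂ] RepFun G} (h : ∀ g k, repEval₂ g k s = repEval₂ g k t) :
    s = t :=
  sub_eq_zero.mp (repEval₂_separating _ fun g k => by rw [map_sub, h, sub_self])

/-- Evaluation of a three-variable representative function. -/
def repEval₃ (g h k : G) : RepFun G ⊗[ℂ] (RepFun G ⊗[ℂ] RepFun G) →ₐ[ℂ] ℂ :=
  productMap (repEval g) (repEval₂ h k)

lemma repEval₃_ext {s t : RepFun G ⊗[ℂ] (RepFun G ⊗[ℂ] RepFun G)}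
    (h : ∀ g k l, repEval₃ g k l s = repEval₃ g k l t) : s = t :=
  sub_eq_zero.mp (tensor_separating repEval (fun p : G × G => repEval₂ p.1 p.2)
    repEval_separating (fun t ht => repEval₂_separating t fun g k => ht (g, k)) _
    fun g p => by
      have := h g p.1 p.2
      rw [map_sub, sub_eq_zero]
      exact this)

variable (G)

/-- All evaluations of a two-variable representative function at once. -/
def repEvalAll : RepFun G ⊗[ℂ] RepFun G →ₐ[ℂ] (G × G → ℂ) :=
  AlgHom.pi fun p : G × G => repEval₂ p.1 p.2

lemma repEvalAll_injective : Function.Injective (repEvalAll G) := fun _ _ h =>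
  repEval₂_ext fun g k => congrFun h (g, k)

/-- The pullback of a representative function along the multiplication. -/
def repPull : RepFun G →ₐ[ℂ] (G × G → ℂ) := AlgHom.pi fun p : G × G => repEval (p.1 * p.2)

variable {G}

lemma repEval₂_sum {ι : Type} [Fintype ι] [DecidableEq ι] (ρ : G →ₜ* Matrix.unitaryGroup ι ℂ)
    (i j : ι) (g h : G) : repEval₂ g h (∑ k, repElt ρ i k ⊗ₜ repElt ρ k j) =
      repEval (g * h) (repElt ρ i j) := by
  rw [map_sum]
  change ∑ k, (ρ g : Matrix ι ι ℂ) i k * (ρ h : Matrix ι ι ℂ) k j =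
    (ρ (g * h) : Matrix ι ι ℂ) i j
  rw [map_mul, Submonoid.coe_mul, Matrix.mul_apply]

lemma repPull_mem (f : RepFun G) : repPull G f ∈ (repEvalAll G).range := by
  obtain ⟨f, hf⟩ := f
  suffices h : ∃ t : RepFun G ⊗[ℂ] RepFun G, ∀ g k, repEval₂ g k t = f (g * k) by
    obtain ⟨t, ht⟩ := h
    exact ⟨t, funext fun p => ht p.1 p.2⟩
  revert hf
  refine repAlg_le (p := fun f => ∃ t : RepFun G ⊗[ℂ] RepFun G,
    ∀ g k, repEval₂ g k t = f (g * k)) ?_ ?_ ?_ ?_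
  · exact ⟨0, fun g k => by simp⟩
  · rintro f f' ⟨t, ht⟩ ⟨t', ht'⟩
    exact ⟨t + t', fun g k => by simp [ht, ht']⟩
  · rintro c f ⟨t, ht⟩
    exact ⟨c • t, fun g k => by simp [ht]⟩
  · exact fun ρ i j => ⟨_, repEval₂_sum ρ i j⟩

variable (G)

/-- The comultiplication of `O(G)`, characterized by `(Δ f)(g, h) = f (g h)`. -/
def repComul : RepFun G →ₐ[ℂ] RepFun G ⊗[ℂ] RepFun G :=
  (AlgEquiv.ofInjective (repEvalAll G) (repEvalAll_injective G)).symm.toAlgHom.comp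
    ((repPull G).codRestrict (repEvalAll G).range repPull_mem)

variable {G}

lemma repEval₂_comul (f : RepFun G) (g h : G) :
    repEval₂ g h (repComul G f) = repEval (g * h) f := by
  have h1 : repEvalAll G (repComul G f) = repPull G f :=
    congrArg Subtype.val ((AlgEquiv.ofInjective (repEvalAll G)
      (repEvalAll_injective G)).apply_symm_apply ⟨repPull G f, repPull_mem f⟩)
  exact congrFun h1 (g, h)

lemma repEval₂_comp_comul (g h : G) : (repEval₂ g h).comp (repComul G) = repEval (g * h) :=
  AlgHom.ext fun f => repEval₂_comul f g h

instance repBialgebra : Bialgebra ℂ (RepFun G) :=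
  Bialgebra.ofAlgHom (repComul G) (repEval 1)
    (by
      refine AlgHom.ext fun f => repEval₃_ext fun g h k => ?_
      have h1 : ((repEval₃ g h k).comp (Algebra.TensorProduct.assoc ℂ ℂ ℂ _ _ _).toAlgHom).comp
          (Algebra.TensorProduct.map (repComul G) (.id ℂ (RepFun G))) = repEval₂ (g * h) k := by
        have h0 : (repEval₃ g h k).comp (Algebra.TensorProduct.assoc ℂ ℂ ℂ _ _ _).toAlgHom =
            productMap (repEval₂ g h) (repEval k) := by
          ext <;> simp [repEval₃, repEval₂, Algebra.TensorProduct.one_def]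
        rw [h0]
        ext f <;> simp [repEval₂, ← repEval₂_comul]
      have h2 : (repEval₃ g h k).comp
          (Algebra.TensorProduct.map (.id ℂ (RepFun G)) (repComul G)) = repEval₂ g (h * k) := by
        ext f <;> simp [repEval₃, repEval₂, ← repEval₂_comul]
      refine (DFunLike.congr_fun h1 (repComul G f)).trans
        (Eq.trans ?_ (DFunLike.congr_fun h2 (repComul G f)).symm)
      rw [repEval₂_comul, repEval₂_comul, mul_assoc])
    (by
      refine AlgHom.ext fun f => (Algebra.TensorProduct.lid ℂ (RepFun G)).injective ?_
      refine Subtype.ext (ContinuousMap.ext fun g => ?_)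
      have h1 : ((repEval g).comp (Algebra.TensorProduct.lid ℂ (RepFun G)).toAlgHom).comp
          (Algebra.TensorProduct.map (repEval (1 : G)) (.id ℂ (RepFun G))) = repEval₂ 1 g := by
        ext f <;> simp [repEval₂]
      refine (DFunLike.congr_fun h1 (repComul G f)).trans ?_
      rw [repEval₂_comul, one_mul]
      simp [repEval_apply])
    (by
      refine AlgHom.ext fun f => (Algebra.TensorProduct.rid ℂ ℂ (RepFun G)).injective ?_
      refine Subtype.ext (ContinuousMap.ext fun g => ?_)
      have h1 : ((repEval g).comp (Algebra.TensorProduct.rid ℂ ℂ (RepFun G)).toAlgHom).comp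
          (Algebra.TensorProduct.map (.id ℂ (RepFun G)) (repEval (1 : G))) = repEval₂ g 1 := by
        ext f <;> simp [repEval₂]
      refine (DFunLike.congr_fun h1 (repComul G f)).trans ?_
      rw [repEval₂_comul, mul_one]
      simp [repEval_apply])

lemma comp_inv_mem [IsTopologicalGroup G] {f : C(G, ℂ)} (hf : f ∈ repAlg G) :
    f.comp ⟨fun g : G => g⁻¹, continuous_inv⟩ ∈ repAlg G := by
  refine repAlg_le (p := fun f : C(G, ℂ) => f.comp ⟨fun g : G => g⁻¹, continuous_inv⟩ ∈ repAlg G)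
    ?_ ?_ ?_ ?_ hf
  · exact (repAlg G).zero_mem
  · exact fun f f' h h' => (repAlg G).add_mem h h'
  · exact fun c f h => (repAlg G).smul_mem h c
  · intro ι _ _ ρ i j
    have h : (repCoeff ρ i j).comp ⟨fun g : G => g⁻¹, continuous_inv⟩ = star (repCoeff ρ j i) := by
      ext g
      change (ρ g⁻¹ : Matrix ι ι ℂ) i j = star ((ρ g : Matrix ι ι ℂ) j i)
      rw [map_inv, Matrix.UnitaryGroup.inv_val, Matrix.star_apply]
    rw [h]
    exact star_mem (s := repAlg G) (Submodule.subset_span (repCoeff_mem ρ j i))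

/-- The antipode `(S f)(g) = f (g⁻¹)`. -/
def repAntipode [IsTopologicalGroup G] : RepFun G →ₗ[ℂ] RepFun G where
  toFun f := ⟨f.1.comp ⟨fun g : G => g⁻¹, continuous_inv⟩, comp_inv_mem f.2⟩
  map_add' _ _ := rfl
  map_smul' _ _ := rfl

instance repHopf [IsTopologicalGroup G] : HopfAlgebra ℂ (RepFun G) where
  antipode := repAntipode
  mul_antipode_rTensor_comul := by
    refine LinearMap.ext fun f => Subtype.ext (ContinuousMap.ext fun g => ?_)
    have h1 : (repEval g).toLinearMap ∘ₗ LinearMap.mul' ℂ (RepFun G) ∘ₗ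
        repAntipode.rTensor (RepFun G) = (repEval₂ g⁻¹ g).toLinearMap := by
      ext a b
      simp only [repEval₂]
      change _ = repEval _ a * repEval _ b
      exact map_mul (repEval g) _ _
    refine (LinearMap.congr_fun h1 (repComul G f)).trans ?_
    refine (repEval₂_comul f g⁻¹ g).trans ?_
    rw [inv_mul_cancel]
    rfl
  mul_antipode_lTensor_comul := by
    refine LinearMap.ext fun f => Subtype.ext (ContinuousMap.ext fun g => ?_)
    have h1 : (repEval g).toLinearMap ∘ₗ LinearMap.mul' ℂ (RepFun G) ∘ₗ
        repAntipode.lTensor (RepFun G) = (repEval₂ g g⁻¹).toLinearMap := by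
      ext a b
      simp only [repEval₂]
      change _ = repEval _ a * repEval _ b
      exact map_mul (repEval g) _ _
    refine (LinearMap.congr_fun h1 (repComul G f)).trans ?_
    refine (repEval₂_comul f g g⁻¹).trans ?_
    rw [mul_inv_cancel]
    rfl

lemma repComul_star (f : RepFun G) :
    Coalgebra.comul (R := ℂ) (star f) = star (Coalgebra.comul (R := ℂ) f) := by
  refine repEval₂_ext fun g h => ?_
  change repEval₂ g h (repComul G (star f)) = repEval₂ g h (star (repComul G f))
  have key : ∀ t : RepFun G ⊗[ℂ] RepFun G, repEval₂ g h (star t) = star (repEval₂ g h t) := by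
    intro t
    induction t using TensorProduct.induction_on with
    | zero => simp
    | add s t hs ht => rw [star_add, map_add, map_add, hs, ht, star_add]
    | tmul a b =>
      change (star a).1 g * (star b).1 h = star (a.1 g * b.1 h)
      rw [star_mul']
      rfl
  rw [key, repEval₂_comul, repEval₂_comul]
  rfl

end RepresentativeFunctions

/-- `u` is the coefficient matrix, with respect to an orthonormal basis `e`, of a unitary comodule
`e j ↦ ∑ i, e i ⊗ u i j` of the Hopf `*`-algebra `A`: coassociativity and counitality of the
coaction amount to the formulas for `Δ (u i j)` and `ε (u i j)`, and the comodule is unitary when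
the matrix `u` is. -/
structure IsUnitaryCoeffMatrix {A : Type u} [Ring A] [StarRing A] [HopfAlgebra ℂ A]
    {ι : Type} [Fintype ι] [DecidableEq ι] (u : Matrix ι ι A) : Prop where
  comul : ∀ i j, Coalgebra.comul (R := ℂ) (u i j) = ∑ k, u i k ⊗ₜ[ℂ] u k j
  counit : ∀ i j, Coalgebra.counit (R := ℂ) (u i j) = if i = j then 1 else 0
  unitary : u ∈ unitary (Matrix ι ι A)

/-- A CQG algebra: a Hopf `*`-algebra over `ℂ` which is the linear span of the coefficients of its
finite-dimensional unitary comodules. -/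
structure CQG : Type (u + 1) where
  carrier : Type u
  [ring : Ring carrier]
  [starRing : StarRing carrier]
  [hopf : HopfAlgebra ℂ carrier]
  [starModule : StarModule ℂ carrier]
  comul_star : ∀ a : carrier, Coalgebra.comul (R := ℂ) (star a) = star (Coalgebra.comul (R := ℂ) a)
  counit_star : ∀ a : carrier,
    Coalgebra.counit (R := ℂ) (star a) = star (Coalgebra.counit (R := ℂ) a)
  span_coeff : Submodule.span ℂ {a : carrier | ∃ (ι : Type) (_ : Fintype ι) (_ : DecidableEq ι)
    (u : Matrix ι ι carrier), IsUnitaryCoeffMatrix u ∧ ∃ i j, a = u i j} = ⊤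

namespace CQG

attribute [instance] CQG.ring CQG.starRing CQG.hopf CQG.starModule

instance : CoeSort CQG.{u} (Type u) := ⟨CQG.carrier⟩

/-- Morphisms of Hopf `*`-algebras: bialgebra homomorphisms commuting with `*` (they automatically
commute with the antipodes). -/
@[ext]
structure Hom (A B : CQG.{u}) where
  hom : A →ₐc[ℂ] B
  map_star : ∀ a, hom (star a) = star (hom a)

instance : Category CQG.{u} where
  Hom := Hom
  id A := ⟨BialgHom.id ℂ A, fun _ => rfl⟩
  comp {A B C} f g := ⟨g.hom.comp f.hom, fun a => by
    rw [BialgHom.comp_apply, f.map_star, g.map_star, BialgHom.comp_apply]⟩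

/-- The underlying `*`-algebra homomorphism. -/
def Hom.toStarAlgHom {A B : CQG.{u}} (f : A ⟶ B) : A →⋆ₐ[ℂ] B :=
  { (f.hom : A →ₐ[ℂ] B) with map_star' := f.map_star }

/-- The commutative CQG algebras. -/
def isCommutative : ObjectProperty CQG.{u} := fun A => ∀ a b : A, a * b = b * a

end CQG

/-- `π : A → B` exhibits `B` as the largest commutative quotient `*`-algebra of `A`. -/
def IsLargestCommQuotientStar {A B : Type u} [Ring A] [StarRing A] [Algebra ℂ A]
    [Ring B] [StarRing B] [Algebra ℂ B] (π : A →⋆ₐ[ℂ] B) : Prop :=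
  Function.Surjective π ∧ (∀ x y : B, x * y = y * x) ∧
    ∀ (C : Type u) [CommRing C] [StarRing C] [Algebra ℂ C] [StarModule ℂ C] (f : A →⋆ₐ[ℂ] C),
      ∃! g : B →⋆ₐ[ℂ] C, g.comp π = f

lemma isUnitaryCoeffMatrix_repElt {G : Type u} [Group G] [TopologicalSpace G] [IsTopologicalGroup G]
    {ι : Type} [Fintype ι] [DecidableEq ι] (ρ : G →ₜ* Matrix.unitaryGroup ι ℂ) :
    IsUnitaryCoeffMatrix (Matrix.of fun i j => repElt ρ i j) where
  comul i j := by
    refine repEval₂_ext fun g h => ?_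
    refine (repEval₂_comul (repElt ρ i j) g h).trans (repEval₂_sum ρ i j g h).symm
  counit i j := by
    change (ρ 1 : Matrix ι ι ℂ) i j = _
    rw [map_one]
    exact Matrix.one_apply
  unitary := by
    have key : ∀ (M N : Matrix ι ι (RepFun G)),
        (∀ g, M.map (fun a => repEval g a) = N.map (fun a => repEval g a)) → M = N := by
      intro M N h
      ext i j
      refine Subtype.ext (ContinuousMap.ext fun g => ?_)
      exact congrFun (congrFun (h g) i) j
    have hU : ∀ g, (Matrix.of fun i j => repElt ρ i j).map (fun a => repEval g a) =
        (ρ g : Matrix ι ι ℂ) := fun g => rfl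
    have hS : ∀ g, (star (Matrix.of fun i j => repElt ρ i j)).map (fun a => repEval g a) =
        star (ρ g : Matrix ι ι ℂ) := fun g => rfl
    have h1 : ∀ g, (1 : Matrix ι ι (RepFun G)).map (fun a => repEval g a) = 1 := fun g =>
      Matrix.map_one _ (map_zero _) (map_one _)
    rw [Unitary.mem_iff]
    constructor
    · refine key _ _ fun g => ?_
      rw [h1, ← Unitary.coe_star_mul_self (ρ g)]
      refine (Matrix.map_mul (f := (repEval g : RepFun G →+* ℂ))).trans ?_
      rfl
    · refine key _ _ fun g => ?_
      rw [h1, ← Unitary.coe_mul_star_self (ρ g)]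
      refine (Matrix.map_mul (f := (repEval g : RepFun G →+* ℂ))).trans ?_
      rfl

/-- The CQG algebra `O(G)` of representative functions on a compact group `G`. -/
def repObj (G : CompGrp.{u}) : CQG.{u} where
  carrier := RepFun G
  comul_star := repComul_star
  counit_star _ := rfl
  span_coeff := by
    rw [eq_top_iff]
    rintro ⟨f, hf⟩ -
    have h : ∃ hf : f ∈ repAlg G, (⟨f, hf⟩ : RepFun G) ∈ Submodule.span ℂ {a : RepFun G |
        ∃ (ι : Type) (_ : Fintype ι) (_ : DecidableEq ι) (u : Matrix ι ι (RepFun G)),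
          IsUnitaryCoeffMatrix u ∧ ∃ i j, a = u i j} := by
      refine repAlg_le (p := fun f => ∃ hf : f ∈ repAlg G, (⟨f, hf⟩ : RepFun G) ∈ Submodule.span ℂ
        {a : RepFun G | ∃ (ι : Type) (_ : Fintype ι) (_ : DecidableEq ι)
          (u : Matrix ι ι (RepFun G)), IsUnitaryCoeffMatrix u ∧ ∃ i j, a = u i j}) ?_ ?_ ?_ ?_ hf
      · exact ⟨(repAlg G).zero_mem, Submodule.zero_mem _⟩
      · rintro f f' ⟨h1, h2⟩ ⟨h1', h2'⟩
        exact ⟨(repAlg G).add_mem h1 h1', Submodule.add_mem _ h2 h2'⟩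
      · rintro c f ⟨h1, h2⟩
        exact ⟨(repAlg G).smul_mem h1 c, Submodule.smul_mem _ c h2⟩
      · intro ι _ _ ρ i j
        exact ⟨(repElt ρ i j).2, Submodule.subset_span
          ⟨ι, _, _, _, isUnitaryCoeffMatrix_repElt ρ, i, j, rfl⟩⟩
    exact h.2

lemma comp_mem_repAlg {G H : Type u} [Group G] [TopologicalSpace G] [Group H] [TopologicalSpace H]
    (φ : H →ₜ* G) {f : C(G, ℂ)} (hf : f ∈ repAlg G) : f.comp (φ : C(H, G)) ∈ repAlg H := by
  refine repAlg_le (p := fun f => f.comp (φ : C(H, G)) ∈ repAlg H) ?_ ?_ ?_ ?_ hf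
  · exact (repAlg H).zero_mem
  · exact fun f f' h h' => (repAlg H).add_mem h h'
  · exact fun c f h => (repAlg H).smul_mem h c
  · exact fun ρ i j => Submodule.subset_span (repCoeff_mem (ρ.comp φ) i j)

/-- Pullback of representative functions along a continuous homomorphism. -/
def repMapAlg {G H : Type u} [Group G] [TopologicalSpace G] [Group H] [TopologicalSpace H]
    (φ : H →ₜ* G) : RepFun G →ₐ[ℂ] RepFun H where
  toFun f := ⟨f.1.comp (φ : C(H, G)), comp_mem_repAlg φ f.2⟩
  map_one' := rfl
  map_mul' _ _ := rfl
  map_zero' := rfl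
  map_add' _ _ := rfl
  commutes' _ := rfl

/-- Pullback of representative functions, as a homomorphism of bialgebras. -/
def repMap {G H : Type u} [Group G] [TopologicalSpace G] [IsTopologicalGroup G] [Group H]
    [TopologicalSpace H] [IsTopologicalGroup H] (φ : H →ₜ* G) : RepFun G →ₐc[ℂ] RepFun H :=
  BialgHom.ofAlgHom (repMapAlg φ)
    (AlgHom.ext fun f => by
      change f.1 (φ 1) = f.1 1
      rw [map_one])
    (AlgHom.ext fun f => repEval₂_ext fun g h => by
      have h1 : (repEval₂ g h).comp (Algebra.TensorProduct.map (repMapAlg φ) (repMapAlg φ)) =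
          repEval₂ (φ g) (φ h) := by
        ext a
        · simp only [repEval₂]
          change repEval g (repMapAlg φ a) * repEval h (repMapAlg φ 1) =
            repEval (φ g) a * repEval (φ h) 1
          rw [map_one, map_one, map_one]
          rfl
        · simp only [repEval₂]
          change repEval g (repMapAlg φ 1) * repEval h (repMapAlg φ a) =
            repEval (φ g) 1 * repEval (φ h) a
          rw [map_one, map_one, map_one]
          rfl
      refine (DFunLike.congr_fun h1 (repComul G f)).trans ?_
      refine Eq.trans ?_ (repEval₂_comul (repMapAlg φ f) g h).symm
      rw [repEval₂_comul, ← map_mul]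
      rfl)

/-- The contravariant functor `G ↦ O(G)`, `φ ↦ (f ↦ f ∘ φ)`. -/
def repFunctor : CompGrp.{u}ᵒᵖ ⥤ CQG.{u} where
  obj G := repObj G.unop
  map φ := ⟨repMap φ.unop.hom, fun _ => rfl⟩
  map_id _ := rfl
  map_comp _ _ := rfl

end

/-!
**Abelianization.** The commutators of a CQG algebra `A` generate a Hopf ideal stable under `*`
(`commutatorIdeal`): `(π ⊗ π) ∘ Δ` and `ε` take values in commutative algebras, and the antipode
reverses products. The quotient is again spanned by coefficients of unitary comodules, namely the
images of those of `A`. For a compact quantum group `A`, the largest commutative quotient is the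
Gelfand transform `π : A → C(X)`, where `X` is the space of characters of the noncommutative algebra
`A`. It is onto (`gelfandQuotient_surjective`): its range is dense by Stone-Weierstrass, and a
`*`-homomorphism of `C*`-algebras with dense range is onto, because self-adjoint elements of the
range lift without increase of norm. The comultiplication of `C(X)` is dual to the convolution
product `X × X → X`.

**Limits.** A full subcategory that is reflective is closed under limits: all legs of a limit cone
over a diagram in it factor through the reflection of the apex, which makes the apex a retract of
its reflection (`exists_retraction_of_isLimit`).

**Compact groups.** For every CQG algebra `A`, commutative or not, the functor `G ↦ Hom(A, O(G))`
on compact groups is represented by the group `H` of `*`-characters of `A` under convolution: a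
morphism `f` corresponds to `g ↦ ev_g ∘ f`, and the universal morphism `A → O(H)` is
`a ↦ (χ ↦ χ a)`. The group `H` is compact since the coefficients of unitary matrices are bounded on
it, and those coefficients become coefficients of unitary representations of `H`. Representability
alone forces `O` to turn colimits into limits (`nonempty_isLimit_mapCone_op`); neither the
Peter-Weyl theorem nor Tannaka duality enters.

For a compact quantum group the characters form a compact semigroup, and the density conditions say
that it is cancellative; if it is nonempty, then it is a compact group
(`exists_one_of_compact_cancel`), which represents `G ↦ Hom(A, C(G))`. A cone over a nonempty
diagram of algebras `C(G j)` provides a character of its apex, so that the same argument applies.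
-/

/-! ### Adjunctions, reflective subcategories and representability -/

section Categorical

variable {C : Type*} [Category* C] {D : Type*} [Category* D]

/-- A functor all of whose comma categories `(X ↓ G)` have an initial object has a left adjoint,
whose unit consists of the chosen initial objects. Since these are only known to exist, a property
`P` that they share is carried over to the unit. -/
theorem exists_adjunction_of_universal (G : D ⥤ C) (P : ∀ {X Y : C}, (X ⟶ Y) → Prop)
    (h : ∀ X : C, ∃ (Y : D) (η : X ⟶ G.obj Y), P η ∧
      ∀ (Z : D) (f : X ⟶ G.obj Z), ∃! g : Y ⟶ Z, η ≫ G.map g = f) :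
    ∃ (L : C ⥤ D) (adj : L ⊣ G), ∀ X, P (adj.unit.app X) := by
  choose L η hP hη using h
  let e : ∀ X Y, (L X ⟶ Y) ≃ (X ⟶ G.obj Y) := fun X Y =>
    Equiv.ofBijective (fun g => η X ≫ G.map g)
      ⟨fun g g' hg => (hη X Y (η X ≫ G.map g)).unique rfl hg.symm, fun f => (hη X Y f).exists⟩
  have he : ∀ X Y Y' g h, e X Y' (h ≫ g) = e X Y h ≫ G.map g := fun X Y Y' g h => by
    change η X ≫ G.map (h ≫ g) = (η X ≫ G.map h) ≫ G.map g
    rw [G.map_comp, Category.assoc]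
  refine ⟨_, Adjunction.adjunctionOfEquivLeft e he, fun X => ?_⟩
  have hu : (Adjunction.adjunctionOfEquivLeft e he).unit.app X = η X := by
    rw [Adjunction.adjunctionOfEquivLeft_unit_app]
    change η X ≫ G.map (𝟙 (L X)) = η X
    rw [G.map_id, Category.comp_id]
  rw [hu]
  exact hP X

/-- The limit of a diagram in a reflective full subcategory is a retract of its reflection: all legs
of the limit cone factor through the unit. -/
theorem exists_retraction_of_isLimit {P : ObjectProperty C} {L : C ⥤ P.FullSubcategory}
    (adj : L ⊣ P.ι) {J : Type*} [Category* J] {F : J ⥤ C} (hF : ∀ j, P (F.obj j))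
    {c : Limits.Cone F} (hc : Limits.IsLimit c) :
    ∃ r : (L.obj c.pt).obj ⟶ c.pt, adj.unit.app c.pt ≫ r = 𝟙 c.pt := by
  let e : ∀ j, (L.obj c.pt ⟶ ⟨F.obj j, hF j⟩) ≃ (c.pt ⟶ F.obj j) :=
    fun j => adj.homEquiv c.pt ⟨F.obj j, hF j⟩
  have he : ∀ j (g : L.obj c.pt ⟶ ⟨F.obj j, hF j⟩), adj.unit.app c.pt ≫ g.hom = e j g :=
    fun j g => (adj.homEquiv_unit c.pt ⟨F.obj j, hF j⟩ g).symm
  have hs : ∀ j, adj.unit.app c.pt ≫ ((e j).symm (c.π.app j)).hom = c.π.app j := fun j => by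
    rw [he, Equiv.apply_symm_apply]
  let s : Limits.Cone F :=
    { pt := (L.obj c.pt).obj
      π := { app := fun j => ((e j).symm (c.π.app j)).hom
             naturality := fun i j f => by
              have h : (e i).symm (c.π.app i) ≫ P.homMk (F.map f) = (e j).symm (c.π.app j) := by
                apply (e j).injective
                rw [← he, ← he, hs, ObjectProperty.FullSubcategory.comp_hom, ← Category.assoc, hs]
                exact c.w f
              have h' := congrArg InducedCategory.Hom.hom h
              exact (Category.id_comp _).trans h'.symm } }
  refine ⟨hc.lift s, hc.hom_ext fun j => ?_⟩
  refine (Category.assoc _ _ _).trans ?_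
  rw [hc.fac]
  exact (hs j).trans (Category.id_comp _).symm

/-- The inclusion of a reflective full subcategory preserves and reflects limits. -/
theorem nonempty_isLimit_iff_of_reflective {P : ObjectProperty C} {L : C ⥤ P.FullSubcategory}
    (adj : L ⊣ P.ι) {J : Type w} [Category.{v} J] (F : J ⥤ P.FullSubcategory)
    (c : Limits.Cone F) :
    Nonempty (Limits.IsLimit c) ↔ Nonempty (Limits.IsLimit (P.ι.mapCone c)) := by
  have := adj.rightAdjoint_preservesLimits
  exact ⟨fun ⟨h⟩ => ⟨Limits.isLimitOfPreserves P.ι h⟩, fun ⟨h⟩ => ⟨Limits.isLimitOfReflects P.ι h⟩⟩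

/-- A contravariant functor `F` turns a colimit cocone into a limit cone as soon as, for the apex
`X` of each competing cone, the functor `G ↦ (X ⟶ F G)` is represented by some object `H`. -/
theorem nonempty_isLimit_mapCone_op (F : Cᵒᵖ ⥤ D) {J : Type*} [Category* J] {K : J ⥤ C}
    {c : Limits.Cocone K} (hc : Limits.IsColimit c)
    (h : ∀ s : Limits.Cone (K.op ⋙ F), ∃ (H : C) (η : s.pt ⟶ F.obj (Opposite.op H)),
      ∀ (G : C) (f : s.pt ⟶ F.obj (Opposite.op G)), ∃! φ : G ⟶ H, η ≫ F.map φ.op = f) :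
    Nonempty (Limits.IsLimit (F.mapCone c.op)) := by
  suffices h' : ∀ s : Limits.Cone (K.op ⋙ F), ∃! l : s.pt ⟶ (F.mapCone c.op).pt,
      ∀ j, l ≫ (F.mapCone c.op).π.app j = s.π.app j by
    choose l hl hu using h'
    exact ⟨{ lift := l, fac := hl, uniq := fun s m hm => hu s m hm }⟩
  intro s
  obtain ⟨H, η, hη⟩ := h s
  choose φ hφ hφu using fun j => hη (K.obj j) (s.π.app (Opposite.op j))
  let t : Limits.Cocone K :=
    { pt := H
      ι := { app := φ
             naturality := fun i j f => by
              have hw := s.w f.op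
              refine (hφu i _ ?_).trans (Category.comp_id _).symm
              change η ≫ F.map (K.map f ≫ φ j).op = _
              rw [op_comp, F.map_comp, ← Category.assoc, hφ]
              exact hw } }
  refine ⟨η ≫ F.map (hc.desc t).op, fun j => ?_, fun l hl => ?_⟩
  · change (η ≫ F.map (hc.desc t).op) ≫ F.map (c.ι.app j.unop).op = _
    rw [Category.assoc, ← F.map_comp, ← op_comp, hc.fac]
    exact hφ j.unop
  · obtain ⟨ψ, hψ, -⟩ := hη c.pt l
    rw [← hψ, hc.uniq t ψ fun j => hφu j _ ?_]
    change η ≫ F.map (c.ι.app j ≫ ψ).op = _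
    rw [op_comp, F.map_comp, ← Category.assoc, hψ]
    exact hl (Opposite.op j)

end Categorical

/-! ### The abelianization of a CQG algebra -/

section CommutatorIdeal

variable (A : Type*) [Ring A]

/-- The two-sided ideal generated by the commutators, as the left ideal generated by their right
multiples. -/
def commutatorIdeal : Ideal A := Ideal.span {x | ∃ a b c : A, x = (a * b - b * a) * c}

variable {A}

lemma commutator_mem_commutatorIdeal (a b : A) : a * b - b * a ∈ commutatorIdeal A :=
  Ideal.subset_span ⟨a, b, 1, (mul_one _).symm⟩

instance : (commutatorIdeal A).IsTwoSided where
  mul_mem_of_left {x} d hx := by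
    induction hx using Submodule.span_induction with
    | mem x hx =>
      obtain ⟨a, b, c, rfl⟩ := hx
      exact Ideal.subset_span ⟨a, b, c * d, mul_assoc _ _ _⟩
    | zero => rw [zero_mul]; exact Ideal.zero_mem _
    | add x y _ _ hx hy => rw [add_mul]; exact Ideal.add_mem _ hx hy
    | smul r x _ hx => rw [smul_eq_mul, mul_assoc]; exact Ideal.mul_mem_left _ r hx

lemma star_mem_commutatorIdeal [StarRing A] {x : A} (hx : x ∈ commutatorIdeal A) :
    star x ∈ commutatorIdeal A := by
  induction hx using Submodule.span_induction with
  | mem x hx =>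
    obtain ⟨a, b, c, rfl⟩ := hx
    rw [star_mul, star_sub, star_mul, star_mul]
    exact Ideal.mul_mem_left _ _ (commutator_mem_commutatorIdeal _ _)
  | zero => rw [star_zero]; exact Ideal.zero_mem _
  | add x y _ _ hx hy => rw [star_add]; exact Ideal.add_mem _ hx hy
  | smul r x _ hx => rw [smul_eq_mul, star_mul]; exact Ideal.mul_mem_right _ _ hx

lemma map_eq_zero_of_mem_commutatorIdeal {B F : Type*} [Ring B] [FunLike F A B] [RingHomClass F A B]
    (f : F) (hf : ∀ a b, f a * f b = f b * f a) {x : A} (hx : x ∈ commutatorIdeal A) :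
    f x = 0 := by
  induction hx using Submodule.span_induction with
  | mem x hx =>
    obtain ⟨a, b, c, rfl⟩ := hx
    rw [map_mul, map_sub, map_mul, map_mul, hf a b, sub_self, zero_mul]
  | zero => exact map_zero f
  | add x y _ _ hx hy => rw [map_add, hx, hy, add_zero]
  | smul r x _ hx => rw [smul_eq_mul, map_mul, hx, mul_zero]

lemma mul_comm_quotient_commutatorIdeal (x y : A ⧸ commutatorIdeal A) : x * y = y * x := by
  obtain ⟨a, rfl⟩ := Ideal.Quotient.mk_surjective x
  obtain ⟨b, rfl⟩ := Ideal.Quotient.mk_surjective y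
  rw [← map_mul, ← map_mul]
  exact Ideal.Quotient.eq.mpr (commutator_mem_commutatorIdeal a b)

instance [StarRing A] : StarRing (A ⧸ commutatorIdeal A) where
  star := Quotient.map' star fun a b h => by
    rw [Submodule.quotientRel_def] at h ⊢
    rw [← star_sub]
    exact star_mem_commutatorIdeal h
  star_involutive x := by
    obtain ⟨a, rfl⟩ := Ideal.Quotient.mk_surjective x
    exact congrArg (Ideal.Quotient.mk (commutatorIdeal A)) (star_star a)
  star_mul x y := by
    obtain ⟨a, rfl⟩ := Ideal.Quotient.mk_surjective x
    obtain ⟨b, rfl⟩ := Ideal.Quotient.mk_surjective y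
    exact congrArg (Ideal.Quotient.mk (commutatorIdeal A)) (star_mul a b)
  star_add x y := by
    obtain ⟨a, rfl⟩ := Ideal.Quotient.mk_surjective x
    obtain ⟨b, rfl⟩ := Ideal.Quotient.mk_surjective y
    exact congrArg (Ideal.Quotient.mk (commutatorIdeal A)) (star_add a b)

instance [StarRing A] [Algebra ℂ A] [StarModule ℂ A] : StarModule ℂ (A ⧸ commutatorIdeal A) where
  star_smul c x := by
    obtain ⟨a, rfl⟩ := Ideal.Quotient.mk_surjective x
    exact congrArg (Ideal.Quotient.mk (commutatorIdeal A)) (star_smul c a)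

lemma TensorProduct.mul_comm_of_mul_comm {R B C : Type*} [CommRing R] [Ring B] [Algebra R B]
    [Ring C] [Algebra R C] (hB : ∀ x y : B, x * y = y * x) (hC : ∀ x y : C, x * y = y * x)
    (s t : B ⊗[R] C) : s * t = t * s := by
  induction s using TensorProduct.induction_on with
  | zero => rw [zero_mul, mul_zero]
  | add s s' hs hs' => rw [add_mul, mul_add, hs, hs']
  | tmul b c =>
    induction t using TensorProduct.induction_on with
    | zero => rw [zero_mul, mul_zero]
    | add t t' ht ht' => rw [add_mul, mul_add, ht, ht']
    | tmul b' c' =>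
      rw [Algebra.TensorProduct.tmul_mul_tmul, Algebra.TensorProduct.tmul_mul_tmul, hB, hC]

/-- The commutators generate a Hopf ideal: both `(π ⊗ π) ∘ Δ` and `ε` are homomorphisms to
commutative algebras, and the antipode reverses products. -/
instance {R : Type*} [CommRing R] [HopfAlgebra R A] : (commutatorIdeal A).IsHopfIdeal R where
  counit_eq_zero x hx :=
    map_eq_zero_of_mem_commutatorIdeal (Bialgebra.counitAlgHom R A) (fun _ _ => mul_comm _ _) hx
  map_mkQ_comul_eq_zero x hx :=
    map_eq_zero_of_mem_commutatorIdeal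
      ((Algebra.TensorProduct.map (Ideal.Quotient.mkₐ R (commutatorIdeal A))
        (Ideal.Quotient.mkₐ R (commutatorIdeal A))).comp (Bialgebra.comulAlgHom R A))
      (fun _ _ => TensorProduct.mul_comm_of_mul_comm mul_comm_quotient_commutatorIdeal
        mul_comm_quotient_commutatorIdeal _ _) hx
  antipode_mem x hx := by
    induction hx using Submodule.span_induction with
    | mem x hx =>
      obtain ⟨a, b, c, rfl⟩ := hx
      rw [HopfAlgebra.antipode_mul_antidistrib, map_sub, HopfAlgebra.antipode_mul_antidistrib,
        HopfAlgebra.antipode_mul_antidistrib]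
      exact Ideal.mul_mem_left _ _ (commutator_mem_commutatorIdeal _ _)
    | zero => rw [map_zero]; exact Ideal.zero_mem _
    | add x y _ _ hx hy => rw [map_add]; exact Ideal.add_mem _ hx hy
    | smul r x _ hx =>
      rw [smul_eq_mul, HopfAlgebra.antipode_mul_antidistrib]
      exact Ideal.mul_mem_right _ _ hx

end CommutatorIdeal

lemma IsUnitaryCoeffMatrix.map {A B : Type u} [Ring A] [StarRing A] [HopfAlgebra ℂ A]
    [Ring B] [StarRing B] [HopfAlgebra ℂ B] (f : A →ₐc[ℂ] B) (hf : ∀ a, f (star a) = star (f a))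
    {ι : Type} [Fintype ι] [DecidableEq ι] {u : Matrix ι ι A} (hu : IsUnitaryCoeffMatrix u) :
    IsUnitaryCoeffMatrix (u.map f) where
  comul i j := by
    rw [Matrix.map_apply, ← CoalgHomClass.map_comp_comul_apply, hu.comul, map_sum]
    rfl
  counit i j := by
    rw [Matrix.map_apply, CoalgHomClass.counit_comp_apply, hu.counit]
  unitary := by
    let F : Matrix ι ι A →+* Matrix ι ι B := ((f : A →ₐ[ℂ] B) : A →+* B).mapMatrix
    have hs : star (F u) = F (star u) := by
      ext i j
      exact (hf _).symm
    change F u ∈ _root_.unitary _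
    rw [Unitary.mem_iff, hs, ← map_mul, ← map_mul, (Unitary.mem_iff.mp hu.unitary).1,
      (Unitary.mem_iff.mp hu.unitary).2, map_one]
    exact ⟨rfl, rfl⟩

noncomputable section

namespace CQG

variable (A : CQG.{u})

/-- The quotient map onto the algebra modulo commutators, as a homomorphism of bialgebras. -/
def mkAbelianization : A →ₐc[ℂ] A ⧸ commutatorIdeal A :=
  Bialgebra.Quotient.mkBialgHom (commutatorIdeal A)

lemma mkAbelianization_surjective : Function.Surjective (mkAbelianization A) :=
  Ideal.Quotient.mk_surjective

/-- The abelianization of a CQG algebra: its quotient by the ideal generated by the commutators. -/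
def abelianization : CQG.{u} where
  carrier := A ⧸ commutatorIdeal A
  comul_star x := by
    obtain ⟨a, rfl⟩ := mkAbelianization_surjective A x
    have key : ∀ t : A ⊗[ℂ] A, TensorProduct.map (mkAbelianization A).toLinearMap
        (mkAbelianization A).toLinearMap (star t) = star (TensorProduct.map
          (mkAbelianization A).toLinearMap (mkAbelianization A).toLinearMap t) := by
      intro t
      induction t using TensorProduct.induction_on with
      | zero => simp
      | add s t hs ht => rw [star_add, map_add, map_add, hs, ht, star_add]
      | tmul a b => rfl
    refine Eq.trans (b := Coalgebra.comul (R := ℂ) (mkAbelianization A (star a))) rfl ?_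
    rw [← CoalgHomClass.map_comp_comul_apply, ← CoalgHomClass.map_comp_comul_apply, A.comul_star]
    exact key _
  counit_star x := by
    obtain ⟨a, rfl⟩ := mkAbelianization_surjective A x
    exact A.counit_star a
  span_coeff := by
    have hr : LinearMap.range (mkAbelianization A).toLinearMap = ⊤ :=
      LinearMap.range_eq_top.mpr (mkAbelianization_surjective A)
    rw [eq_top_iff, ← hr, ← Submodule.map_top, ← A.span_coeff, Submodule.map_span]
    refine Submodule.span_mono ?_
    rintro _ ⟨_, ⟨ι, _, _, u, hu, i, j, rfl⟩, rfl⟩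
    exact ⟨ι, _, _, _, hu.map (mkAbelianization A) (fun _ => rfl), i, j, rfl⟩

/-- The quotient map from a CQG algebra to its abelianization. -/
def toAbelianization : A ⟶ abelianization A := ⟨mkAbelianization A, fun _ => rfl⟩

variable {A}

lemma hom_ext_apply {B : CQG.{u}} {f g : A ⟶ B} (h : ∀ a : A, f.hom a = g.hom a) : f = g :=
  Hom.ext (BialgHom.ext h)

lemma isLargestCommQuotientStar_toAbelianization :
    IsLargestCommQuotientStar (Hom.toStarAlgHom (toAbelianization A)) := by
  refine ⟨mkAbelianization_surjective A, mul_comm_quotient_commutatorIdeal (A := A),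
    fun C _ _ _ _ f => ?_⟩
  let g : A ⧸ commutatorIdeal A →ₐ[ℂ] C := Ideal.Quotient.liftₐ _ f.toAlgHom fun x hx =>
    map_eq_zero_of_mem_commutatorIdeal f.toAlgHom (fun _ _ => mul_comm _ _) hx
  refine ⟨{ g with
    map_star' := fun x => by
      obtain ⟨a, rfl⟩ := Ideal.Quotient.mk_surjective x
      exact map_star f a }, StarAlgHom.ext fun a => rfl, fun g' hg' => StarAlgHom.ext fun x => ?_⟩
  obtain ⟨a, rfl⟩ := Ideal.Quotient.mk_surjective x
  exact DFunLike.congr_fun hg' a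

lemma existsUnique_desc_abelianization {B : CQG.{u}} (hB : isCommutative B) (f : A ⟶ B) :
    ∃! g : abelianization A ⟶ B, toAbelianization A ≫ g = f := by
  let g : A ⧸ commutatorIdeal A →ₐ[ℂ] B := Ideal.Quotient.liftₐ _ (f.hom : A →ₐ[ℂ] B) fun x hx =>
    map_eq_zero_of_mem_commutatorIdeal (f.hom : A →ₐ[ℂ] B) (fun _ _ => hB _ _) hx
  refine ⟨⟨BialgHom.ofAlgHom g (AlgHom.ext fun x => ?_) (AlgHom.ext fun x => ?_), fun x => ?_⟩,
    hom_ext_apply fun a => rfl, fun g' hg' => hom_ext_apply fun x => ?_⟩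
  · obtain ⟨a, rfl⟩ := Ideal.Quotient.mk_surjective x
    exact CoalgHomClass.counit_comp_apply f.hom a
  · obtain ⟨a, rfl⟩ := Ideal.Quotient.mk_surjective x
    refine Eq.trans ?_ (CoalgHomClass.map_comp_comul_apply f.hom a)
    change TensorProduct.map g.toLinearMap g.toLinearMap (TensorProduct.map
      (mkAbelianization A).toLinearMap (mkAbelianization A).toLinearMap _) = _
    rw [← LinearMap.comp_apply, ← TensorProduct.map_comp]
    rfl
  · obtain ⟨a, rfl⟩ := Ideal.Quotient.mk_surjective x
    exact f.map_star a
  · obtain ⟨a, rfl⟩ := Ideal.Quotient.mk_surjective x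
    exact congrArg (fun h : A ⟶ B => h.hom a) hg'

end CQG

end

/-! ### The compact group of `*`-characters of a CQG algebra -/

noncomputable section

namespace CQG

open WithConv

variable {A : CQG.{u}}

/-- The involution `χ ↦ (a ↦ conj (χ (a⋆)))` of the characters. -/
def conjCharacter (χ : A →ₐ[ℂ] ℂ) : A →ₐ[ℂ] ℂ where
  toFun a := star (χ (star a))
  map_one' := by simp
  map_mul' a b := by rw [star_mul, map_mul, star_mul]
  map_zero' := by simp
  map_add' a b := by rw [star_add, map_add, star_add]
  commutes' c := by
    rw [Algebra.algebraMap_eq_smul_one, star_smul, star_one, map_smul, map_one, star_smul,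
      star_star, star_one, Algebra.algebraMap_eq_smul_one]

lemma conjCharacter_mul_conjCharacter (χ ψ : A →ₐ[ℂ] ℂ) :
    toConv (conjCharacter χ) * toConv (conjCharacter ψ) =
      toConv (conjCharacter (toConv χ * toConv ψ).ofConv) := by
  refine WithConv.ext (AlgHom.ext fun a => ?_)
  change _ = star ((toConv χ * toConv ψ) (star a))
  rw [AlgHom.convMul_apply, AlgHom.convMul_apply, A.comul_star]
  generalize Coalgebra.comul (R := ℂ) a = t
  induction t using TensorProduct.induction_on with
  | zero => simp
  | add s t hs ht => rw [star_add, map_add, map_add, hs, ht, star_add]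
  | tmul a b =>
    rw [TensorProduct.star_tmul, Algebra.TensorProduct.lift_tmul, Algebra.TensorProduct.lift_tmul,
      star_mul']
    rfl

lemma conjCharacter_eq_self_iff (χ : A →ₐ[ℂ] ℂ) :
    conjCharacter χ = χ ↔ ∀ a, χ (star a) = star (χ a) :=
  AlgHom.ext_iff.trans (forall_congr' fun _ => star_eq_iff_star_eq.trans eq_comm)

variable (A) in
/-- The `*`-characters of a CQG algebra, as a submonoid of the monoid of all algebra homomorphisms
to `ℂ` under convolution. -/
def starCharacters : Submonoid (WithConv (A →ₐ[ℂ] ℂ)) where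
  carrier := {χ | ∀ a, χ (star a) = star (χ a)}
  one_mem' a := by
    rw [AlgHom.convOne_apply, AlgHom.convOne_apply, A.counit_star]
    rfl
  mul_mem' {χ ψ} hχ hψ := by
    have h := conjCharacter_mul_conjCharacter χ.ofConv ψ.ofConv
    rw [(conjCharacter_eq_self_iff _).mpr hχ, (conjCharacter_eq_self_iff _).mpr hψ] at h
    exact (conjCharacter_eq_self_iff _).mp (WithConv.ext_iff.mp h).symm

instance : FunLike (starCharacters A) A ℂ where
  coe χ := χ.1.ofConv
  coe_injective _ _ h := Subtype.ext (WithConv.ext (DFunLike.coe_injective h))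

instance : AlgHomClass (starCharacters A) ℂ A ℂ where
  map_mul χ := map_mul χ.1.ofConv
  map_one χ := map_one χ.1.ofConv
  map_add χ := map_add χ.1.ofConv
  map_zero χ := map_zero χ.1.ofConv
  commutes χ := AlgHomClass.commutes χ.1.ofConv

lemma starCharacters_map_star (χ : starCharacters A) (a : A) : χ (star a) = star (χ a) := χ.2 a

/-- The homomorphism `χ ⊗ ψ : A ⊗ A → ℂ`, for characters `χ` and `ψ`. -/
def tensorCharacter (χ ψ : A →ₐ[ℂ] ℂ) : A ⊗[ℂ] A →ₐ[ℂ] ℂ :=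
  Algebra.TensorProduct.lift χ ψ fun _ _ => .all _ _

lemma starCharacters_mul_apply (χ ψ : starCharacters A) (a : A) :
    (χ * ψ) a = tensorCharacter χ.1.ofConv ψ.1.ofConv (Coalgebra.comul (R := ℂ) a) :=
  AlgHom.convMul_apply _ _ _

/-- The composition of a character with the antipode. -/
def antipodeCharacter (χ : A →ₐ[ℂ] ℂ) : A →ₐ[ℂ] ℂ :=
  AlgHom.ofLinearMap (χ.toLinearMap ∘ₗ HopfAlgebra.antipode ℂ)
    (by rw [LinearMap.comp_apply, HopfAlgebra.antipode_one]; exact map_one χ)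
    (fun a b => by
      rw [LinearMap.comp_apply, HopfAlgebra.antipode_mul_antidistrib]
      exact (map_mul χ _ _).trans (mul_comm _ _))

lemma antipodeCharacter_mul (χ : A →ₐ[ℂ] ℂ) : toConv (antipodeCharacter χ) * toConv χ = 1 := by
  refine WithConv.ext (AlgHom.ext fun a => ?_)
  have h : tensorCharacter (antipodeCharacter χ) χ (Coalgebra.comul (R := ℂ) a) =
      χ (LinearMap.mul' ℂ A (HopfAlgebra.antipode ℂ |>.rTensor A <| Coalgebra.comul a)) := by
    generalize Coalgebra.comul (R := ℂ) a = t
    induction t using TensorProduct.induction_on with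
    | zero => simp
    | add s t hs ht => simp only [map_add, hs, ht]
    | tmul a b => exact (map_mul χ _ _).symm
  refine (AlgHom.convMul_apply _ _ _).trans (h.trans ?_)
  rw [HopfAlgebra.mul_antipode_rTensor_comul_apply]
  exact AlgHomClass.commutes χ _

lemma mul_antipodeCharacter (χ : A →ₐ[ℂ] ℂ) : toConv χ * toConv (antipodeCharacter χ) = 1 := by
  refine WithConv.ext (AlgHom.ext fun a => ?_)
  have h : tensorCharacter χ (antipodeCharacter χ) (Coalgebra.comul (R := ℂ) a) =
      χ (LinearMap.mul' ℂ A (HopfAlgebra.antipode ℂ |>.lTensor A <| Coalgebra.comul a)) := by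
    generalize Coalgebra.comul (R := ℂ) a = t
    induction t using TensorProduct.induction_on with
    | zero => simp
    | add s t hs ht => simp only [map_add, hs, ht]
    | tmul a b => exact (map_mul χ _ _).symm
  refine (AlgHom.convMul_apply _ _ _).trans (h.trans ?_)
  rw [HopfAlgebra.mul_antipode_lTensor_comul_apply]
  exact AlgHomClass.commutes χ _

/-- The antipode turns `*`-characters into `*`-characters: the convolution inverse of a fixed point
of the involution `conjCharacter` is a fixed point. -/
lemma antipodeCharacter_mem {χ : WithConv (A →ₐ[ℂ] ℂ)} (hχ : χ ∈ starCharacters A) :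
    toConv (antipodeCharacter χ.ofConv) ∈ starCharacters A := by
  have h1 := (conjCharacter_eq_self_iff _).mpr hχ
  have h2 := (conjCharacter_eq_self_iff _).mpr (starCharacters A).one_mem
  have h3 : toConv (conjCharacter (antipodeCharacter χ.ofConv)) * χ = 1 := by
    have h := conjCharacter_mul_conjCharacter (antipodeCharacter χ.ofConv) χ.ofConv
    rw [h1, antipodeCharacter_mul, h2] at h
    exact h
  have h4 := left_inv_eq_right_inv h3 (mul_antipodeCharacter χ.ofConv)
  exact (conjCharacter_eq_self_iff _).mp (WithConv.ext_iff.mp h4)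

instance : Group (starCharacters A) where
  inv χ := ⟨toConv (antipodeCharacter χ.1.ofConv), antipodeCharacter_mem χ.2⟩
  inv_mul_cancel χ := Subtype.ext (antipodeCharacter_mul χ.1.ofConv)

/-- The topology of pointwise convergence. -/
instance : TopologicalSpace (starCharacters A) := .induced (fun χ a => χ a) inferInstance

lemma isInducing_starCharacters : Topology.IsInducing fun (χ : starCharacters A) (a : A) => χ a :=
  ⟨rfl⟩

lemma continuous_starCharacters_apply (a : A) : Continuous fun χ : starCharacters A => χ a :=
  (continuous_apply a).comp isInducing_starCharacters.continuous

lemma continuous_starCharacters_iff {X : Type*} [TopologicalSpace X] {f : X → starCharacters A} :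
    Continuous f ↔ ∀ a, Continuous fun x => f x a :=
  isInducing_starCharacters.continuous_iff.trans continuous_pi_iff

instance : T2Space (starCharacters A) :=
  .of_injective_continuous DFunLike.coe_injective isInducing_starCharacters.continuous

instance : IsTopologicalGroup (starCharacters A) where
  continuous_mul := by
    refine continuous_starCharacters_iff.mpr fun a => ?_
    simp only [starCharacters_mul_apply]
    generalize Coalgebra.comul (R := ℂ) a = t
    induction t using TensorProduct.induction_on with
    | zero => simpa only [map_zero] using continuous_const
    | add s t hs ht => simp only [map_add]; exact hs.add ht
    | tmul a b =>
      exact ((continuous_starCharacters_apply a).comp continuous_fst).mul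
        ((continuous_starCharacters_apply b).comp continuous_snd)
  continuous_inv := continuous_starCharacters_iff.mpr fun a =>
    continuous_starCharacters_apply (HopfAlgebra.antipode ℂ a)

lemma map_mem_unitaryGroup (χ : starCharacters A) {ι : Type} [Fintype ι] [DecidableEq ι]
    {u : Matrix ι ι A} (hu : u ∈ unitary (Matrix ι ι A)) : u.map χ ∈ Matrix.unitaryGroup ι ℂ := by
  let F : Matrix ι ι A →+* Matrix ι ι ℂ := (χ.1.ofConv : A →+* ℂ).mapMatrix
  have hs : star (F u) = F (star u) := by
    ext i j
    exact (χ.2 _).symm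
  change F u ∈ unitary _
  rw [Unitary.mem_iff, hs, ← map_mul, ← map_mul, (Unitary.mem_iff.mp hu).1,
    (Unitary.mem_iff.mp hu).2, map_one]
  exact ⟨rfl, rfl⟩

/-- The values of the `*`-characters at a fixed element are bounded, since the entries of unitary
matrices are. -/
lemma exists_norm_starCharacters_le (a : A) : ∃ r : ℝ, ∀ χ : starCharacters A, ‖χ a‖ ≤ r := by
  have ha : a ∈ Submodule.span ℂ {a : A | ∃ (ι : Type) (_ : Fintype ι) (_ : DecidableEq ι)
      (u : Matrix ι ι A), IsUnitaryCoeffMatrix u ∧ ∃ i j, a = u i j} :=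
    A.span_coeff ▸ Submodule.mem_top
  induction ha using Submodule.span_induction with
  | mem a ha =>
    obtain ⟨ι, _, _, u, hu, i, j, rfl⟩ := ha
    exact ⟨1, fun χ => entry_norm_bound_of_unitary (map_mem_unitaryGroup χ hu.unitary) i j⟩
  | zero => exact ⟨0, fun χ => by rw [map_zero, norm_zero]⟩
  | add a b _ _ ha hb =>
    obtain ⟨r, hr⟩ := ha
    obtain ⟨s, hs⟩ := hb
    exact ⟨r + s, fun χ => by rw [map_add]; exact norm_add_le_of_le (hr χ) (hs χ)⟩
  | smul c a _ ha =>
    obtain ⟨r, hr⟩ := ha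
    exact ⟨‖c‖ * r, fun χ => by
      rw [map_smul, norm_smul]; exact mul_le_mul_of_nonneg_left (hr χ) (norm_nonneg c)⟩

lemma range_starCharacters : Set.range (fun (χ : starCharacters A) (a : A) => χ a) =
    {f | f 1 = 1} ∩ {f | ∀ a b, f (a + b) = f a + f b} ∩ {f | ∀ a b, f (a * b) = f a * f b} ∩
      {f | ∀ (c : ℂ) a, f (c • a) = c • f a} ∩ {f | ∀ a, f (star a) = star (f a)} := by
  ext f
  constructor
  · rintro ⟨χ, rfl⟩
    exact ⟨⟨⟨⟨map_one χ, map_add χ⟩, map_mul χ⟩, map_smul χ⟩, starCharacters_map_star χ⟩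
  · rintro ⟨⟨⟨⟨h1, hadd⟩, hmul⟩, hsmul⟩, hstar⟩
    exact ⟨⟨toConv (AlgHom.ofLinearMap ⟨⟨f, hadd⟩, hsmul⟩ h1 hmul), hstar⟩, rfl⟩

lemma isClosed_range_starCharacters :
    IsClosed (Set.range fun (χ : starCharacters A) (a : A) => χ a) := by
  rw [range_starCharacters]
  simp only [Set.ofPred_forall]
  refine (((?_ : IsClosed _).inter ?_).inter ?_ |>.inter ?_).inter ?_
  · exact isClosed_eq (continuous_apply _) continuous_const
  · exact isClosed_iInter fun a => isClosed_iInter fun b =>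
      isClosed_eq (continuous_apply _) ((continuous_apply a).add (continuous_apply b))
  · exact isClosed_iInter fun a => isClosed_iInter fun b =>
      isClosed_eq (continuous_apply _) ((continuous_apply a).mul (continuous_apply b))
  · exact isClosed_iInter fun c => isClosed_iInter fun b =>
      isClosed_eq (continuous_apply _) ((continuous_apply b).const_smul c)
  · exact isClosed_iInter fun a => isClosed_eq (continuous_apply _) (continuous_apply a).star

instance : CompactSpace (starCharacters A) := by
  rw [← isCompact_univ_iff, isInducing_starCharacters.isCompact_iff, Set.image_univ]
  choose r hr using exists_norm_starCharacters_le (A := A)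
  refine (isCompact_univ_pi fun a : A => isCompact_closedBall (0 : ℂ) (r a)).of_isClosed_subset
    isClosed_range_starCharacters ?_
  rintro _ ⟨χ, rfl⟩ a -
  exact mem_closedBall_zero_iff.mpr (hr a χ)

variable (A) in
/-- The compact group of `*`-characters of a CQG algebra. -/
def characterGroup : CompGrp.{u} where
  carrier := starCharacters A

/-- The unitary representation of the character group given by a unitary comodule. -/
def characterRep {ι : Type} [Fintype ι] [DecidableEq ι] {u : Matrix ι ι A}
    (hu : IsUnitaryCoeffMatrix u) : starCharacters A →ₜ* Matrix.unitaryGroup ι ℂ where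
  toFun χ := ⟨u.map χ, map_mem_unitaryGroup χ hu.unitary⟩
  map_one' := Subtype.ext (by
    ext i j
    change Coalgebra.counit (R := ℂ) (u i j) = _
    rw [hu.counit]
    exact Matrix.one_apply.symm)
  map_mul' χ ψ := Subtype.ext (by
    ext i j
    change (χ * ψ) (u i j) = (u.map χ * u.map ψ) i j
    rw [starCharacters_mul_apply, hu.comul, map_sum, Matrix.mul_apply]
    rfl)
  continuous_toFun := Continuous.subtype_mk
    (continuous_matrix fun i j => continuous_starCharacters_apply (u i j)) _

variable (A) in
/-- The algebra homomorphism `a ↦ (χ ↦ χ a)` to the continuous functions on the character group. -/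
def characterEval : A →ₐ[ℂ] C(starCharacters A, ℂ) where
  toFun a := ⟨fun χ => χ a, continuous_starCharacters_apply a⟩
  map_one' := ContinuousMap.ext fun χ => map_one χ
  map_mul' a b := ContinuousMap.ext fun χ => map_mul χ a b
  map_zero' := ContinuousMap.ext fun χ => map_zero χ
  map_add' a b := ContinuousMap.ext fun χ => map_add χ a b
  commutes' c := ContinuousMap.ext fun χ => AlgHomClass.commutes χ c

lemma characterEval_mem_repAlg (a : A) :
    characterEval A a ∈ (repAlg (starCharacters A)).toSubalgebra := by
  have h : (⊤ : Submodule ℂ A) ≤ (repAlg (starCharacters A)).toSubalgebra.toSubmodule.comap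
      (characterEval A).toLinearMap := by
    rw [← A.span_coeff, Submodule.span_le]
    rintro _ ⟨ι, _, _, u, hu, i, j, rfl⟩
    exact (repElt (characterRep hu) i j).2
  exact h (Submodule.mem_top (x := a))

variable (A) in
/-- The algebra homomorphism `a ↦ (χ ↦ χ a)` to the representative functions. -/
def characterEvalRep : A →ₐ[ℂ] RepFun (starCharacters A) :=
  (characterEval A).codRestrict _ characterEval_mem_repAlg

lemma repEval₂_map {G : Type u} [Group G] [TopologicalSpace G] (f : A →ₐ[ℂ] RepFun G) (g h : G)
    (t : A ⊗[ℂ] A) : repEval₂ g h (Algebra.TensorProduct.map f f t) =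
      tensorCharacter ((repEval g).comp f) ((repEval h).comp f) t := by
  induction t using TensorProduct.induction_on with
  | zero => simp
  | add s t hs ht => simp only [map_add, hs, ht]
  | tmul a b => rfl

variable (A) in
/-- The canonical morphism from a CQG algebra to the representative functions on its character
group. -/
def toRepCharacterGroup : A ⟶ repObj (characterGroup A) :=
  ⟨BialgHom.ofAlgHom (characterEvalRep A) (AlgHom.ext fun _ => rfl)
    (AlgHom.ext fun a => repEval₂_ext fun χ ψ => by
      refine (repEval₂_map (characterEvalRep A) χ ψ _).trans ?_
      refine Eq.trans ?_ (repEval₂_comul (characterEvalRep A a) χ ψ).symm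
      exact (starCharacters_mul_apply χ ψ a).symm),
    fun a => Subtype.ext (ContinuousMap.ext fun χ => starCharacters_map_star χ a)⟩

/-- The algebra homomorphism underlying a morphism `A ⟶ O(G)`. -/
def homToRepFun {G : CompGrp.{u}} (f : A ⟶ repObj G) : A →ₐ[ℂ] RepFun G :=
  (f.hom : A →ₐ[ℂ] (repObj G : CQG.{u}))

/-- The homomorphism from a compact group `G` to the character group of `A` that corresponds to a
morphism `A ⟶ O(G)`. -/
def characterOfHom {G : CompGrp.{u}} (f : A ⟶ repObj G) : G ⟶ characterGroup A where
  hom :=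
    { toFun := fun g => (⟨toConv ((repEval (G := G) g).comp (homToRepFun f)), fun a =>
        congrArg (repEval (G := G) g) (f.map_star a)⟩ : starCharacters A)
      map_one' := DFunLike.ext (F := starCharacters A) _ _ fun a =>
        CoalgHomClass.counit_comp_apply f.hom a
      map_mul' := fun g h => DFunLike.ext (F := starCharacters A) _ _ fun a => by
        refine Eq.trans ?_ (starCharacters_mul_apply _ _ a).symm
        refine Eq.trans ?_ (repEval₂_map (homToRepFun f) g h _)
        refine (repEval₂_comul (G := G) (f.hom a) g h).symm.trans ?_
        exact congrArg (repEval₂ (G := G) g h) (CoalgHomClass.map_comp_comul_apply f.hom a).symm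
      continuous_toFun := continuous_starCharacters_iff.mpr fun a =>
        ContinuousMap.continuous (Subtype.val (p := (· ∈ repAlg G)) (f.hom a)) }

/-- The character group of `A` represents the functor `G ↦ (A ⟶ O(G))`. -/
lemma existsUnique_characterGroup {G : CompGrp.{u}} (f : A ⟶ repObj G) :
    ∃! φ : G ⟶ characterGroup A, toRepCharacterGroup A ≫ repFunctor.map φ.op = f := by
  refine ⟨characterOfHom f, hom_ext_apply fun a => rfl, fun φ hφ => ?_⟩
  subst hφ
  rfl

end CQG

end

/-! ### The abelianization of a `C*`-algebra -/

section SurjectiveOfDense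

variable {A B : Type*} [CStarAlgebra A] [CStarAlgebra B]

open scoped ComplexStarModule in
/-- Self-adjoint elements in the range of a `*`-homomorphism lift to elements of no larger norm:
truncate a self-adjoint lift by the functional calculus. -/
lemma StarAlgHom.exists_norm_le_of_isSelfAdjoint (f : A →⋆ₐ[ℂ] B) {b : B} (hb : IsSelfAdjoint b)
    (h : b ∈ Set.range f) : ∃ a, f a = b ∧ ‖a‖ ≤ ‖b‖ := by
  obtain ⟨a₀, rfl⟩ := h
  have ha : f (ℜ a₀ : A) = f a₀ := by
    rw [map_realPart, hb.coe_realPart]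
  let g : ℝ → ℝ := fun x => max (-‖f a₀‖) (min ‖f a₀‖ x)
  have hg : Continuous g := by fun_prop
  -- `f` commutes with the functional calculus, and `g` is the identity on the spectrum of `f a₀`.
  refine ⟨cfc g (ℜ a₀ : A), ?_, norm_cfc_le (norm_nonneg _) fun x _ => ?_⟩
  · refine (StarAlgHom.map_cfc f g (ℜ a₀ : A) hg.continuousOn
      (MinTensor.continuous_starAlgHom f) (ℜ a₀).2 (by rw [ha]; exact hb)).trans ?_
    rw [ha]
    refine (cfc_congr fun x hx => ?_).trans (cfc_id ℝ (f a₀) hb)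
    -- In the zero algebra the spectrum is empty.
    have : Nontrivial B := by
      by_contra hB
      rw [not_nontrivial_iff_subsingleton] at hB
      rw [spectrum.of_subsingleton] at hx
      exact hx
    have hx' : |x| ≤ ‖f a₀‖ := by
      have := spectrum.norm_le_norm_of_mem hx
      rwa [Real.norm_eq_abs] at this
    obtain ⟨h1, h2⟩ := abs_le.mp hx'
    simp only [g, id, min_eq_right h2, max_eq_right h1]
  · rw [Real.norm_eq_abs, abs_le]
    exact ⟨le_max_left _ _, max_le (by linarith [norm_nonneg (f a₀)]) (min_le_left _ _)⟩

open scoped ComplexStarModule in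
lemma StarAlgHom.surjective_of_denseRange (f : A →⋆ₐ[ℂ] B) (hf : DenseRange f) :
    Function.Surjective f := by
  let F : NormedAddGroupHom A B :=
    (f : A →+ B).mkNormedAddGroupHom 1 fun a => by
      rw [one_mul]; exact NonUnitalStarAlgHom.norm_apply_le f a
  have hF : F.SurjectiveOnWith F.range 2 := by
    rintro _ ⟨a, rfl⟩
    obtain ⟨x, hx, hx'⟩ := f.exists_norm_le_of_isSelfAdjoint (b := f (ℜ a)) ((ℜ a).2.map f) ⟨_, rfl⟩
    obtain ⟨y, hy, hy'⟩ := f.exists_norm_le_of_isSelfAdjoint (b := f (ℑ a)) ((ℑ a).2.map f) ⟨_, rfl⟩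
    have h1 : ‖f (ℜ a : A)‖ ≤ ‖f a‖ := map_realPart f a ▸ realPart.norm_le (f a)
    have h2 : ‖f (ℑ a : A)‖ ≤ ‖f a‖ := map_imaginaryPart f a ▸ imaginaryPart.norm_le (f a)
    refine ⟨x + Complex.I • y, ?_, ?_⟩
    · change f (x + Complex.I • y) = f a
      rw [map_add, map_smul, hx, hy, ← map_smul, ← map_add, realPart_add_I_smul_imaginaryPart]
    · change _ ≤ 2 * ‖f a‖
      refine (norm_add_le _ _).trans ?_
      rw [norm_smul, Complex.norm_I, one_mul]
      linarith
  intro b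
  have hb : b ∈ F.range.topologicalClosure := hf b
  obtain ⟨a, ha, -⟩ := controlled_closure_of_complete two_pos one_pos hF b hb
  exact ⟨a, ha⟩

end SurjectiveOfDense

section Gelfand

open WeakDual

variable (A : Type u) [CStarAlgebra A]

noncomputable section

/-- The Gelfand transform `a ↦ (χ ↦ χ a)` of a possibly noncommutative `C*`-algebra. -/
def gelfandQuotient : A →⋆ₐ[ℂ] C(characterSpace ℂ A, ℂ) :=
  { gelfandTransform ℂ A with
    map_star' := fun a => ContinuousMap.ext fun χ => map_star χ a }

end

variable {A}

lemma gelfandQuotient_surjective : Function.Surjective (gelfandQuotient A) := by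
  apply StarAlgHom.surjective_of_denseRange
  have h := ContinuousMap.starSubalgebra_topologicalClosure_eq_top_of_separatesPoints
    (gelfandQuotient A).range fun χ ψ hχψ => by
      obtain ⟨a, ha⟩ := DFunLike.ne_iff.mp hχψ
      exact ⟨gelfandQuotient A a, ⟨_, ⟨a, rfl⟩, rfl⟩, ha⟩
  intro F
  have hF : F ∈ (gelfandQuotient A).range.topologicalClosure := h ▸ trivial
  rw [← SetLike.mem_coe, StarSubalgebra.topologicalClosure_coe] at hF
  exact hF

lemma existsUnique_comp_gelfandQuotient {C : Type*} [CommCStarAlgebra C] (f : A →⋆ₐ[ℂ] C) :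
    ∃! g : C(characterSpace ℂ A, ℂ) →⋆ₐ[ℂ] C, g.comp (gelfandQuotient A) = f := by
  refine ⟨((gelfandStarTransform C).symm : _ →⋆ₐ[ℂ] C).comp
    (ContinuousMap.compStarAlgHom' ℂ ℂ (CharacterSpace.compContinuousMap f)),
    StarAlgHom.ext fun a => ?_, fun g hg => StarAlgHom.ext fun F => ?_⟩
  · exact (gelfandStarTransform C).symm_apply_apply (f a)
  · obtain ⟨a, rfl⟩ := gelfandQuotient_surjective F
    exact (DFunLike.congr_fun hg a).trans ((gelfandStarTransform C).symm_apply_apply (f a)).symm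

lemma isLargestCommQuotientCStar_gelfandQuotient :
    IsLargestCommQuotientCStar (gelfandQuotient A) :=
  ⟨gelfandQuotient_surjective, mul_comm, fun _ _ f => existsUnique_comp_gelfandQuotient f⟩

end Gelfand

/-! ### Compact cancellative semigroups -/

section CompactSemigroup

variable {M : Type*} [Semigroup M] [TopologicalSpace M] [CompactSpace M] [T2Space M]
  [ContinuousMul M] [IsCancelMul M]

/-- A nonempty compact cancellative semigroup has a unit and inverses: an idempotent is a unit, and
every left ideal `M x` contains an idempotent. -/
lemma exists_one_of_compact_cancel [Nonempty M] :
    ∃ e : M, (∀ x, e * x = x) ∧ ∀ x, ∃ y, y * x = e := by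
  have hc : ∀ r : M, Continuous (· * r) := fun r => continuous_mul_const r
  obtain ⟨e, he⟩ := exists_idempotent_of_compact_t2_of_continuous_mul_left hc
  have he1 : ∀ x, e * x = x := fun x => mul_left_cancel (a := e) (by rw [← mul_assoc, he])
  refine ⟨e, he1, fun x => ?_⟩
  obtain ⟨_, ⟨y, rfl⟩, hy⟩ := exists_idempotent_in_compact_subsemigroup hc (Set.range (· * x))
    (Set.range_nonempty _) (isCompact_range (hc x))
    (by rintro _ ⟨a, rfl⟩ _ ⟨b, rfl⟩; exact ⟨a * x * b, mul_assoc _ _ _⟩)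
  exact ⟨y, mul_right_cancel (b := y * x) (hy.trans (he1 _).symm)⟩

variable (M) in
/-- The group structure of a nonempty compact cancellative semigroup. -/
noncomputable abbrev groupOfCompactCancel [Nonempty M] : Group M :=
  letI : One M := ⟨(exists_one_of_compact_cancel (M := M)).choose⟩
  letI : Inv M := ⟨fun x => ((exists_one_of_compact_cancel (M := M)).choose_spec.2 x).choose⟩
  Group.ofLeftAxioms mul_assoc (exists_one_of_compact_cancel (M := M)).choose_spec.1
    fun x => ((exists_one_of_compact_cancel (M := M)).choose_spec.2 x).choose_spec

/-- In a compact Hausdorff group with continuous multiplication, inversion is continuous, because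
the shear map `(x, y) ↦ (x, x y)` is a homeomorphism. -/
lemma IsTopologicalGroup.of_compact (G : Type*) [Group G] [TopologicalSpace G] [CompactSpace G]
    [T2Space G] [ContinuousMul G] : IsTopologicalGroup G where
  continuous_inv := by
    let s : G × G ≃ G × G :=
      { toFun := fun p => (p.1, p.1 * p.2)
        invFun := fun p => (p.1, p.1⁻¹ * p.2)
        left_inv := fun p => by simp
        right_inv := fun p => by simp }
    have hs : Continuous s := by
      change Continuous fun p : G × G => (p.1, p.1 * p.2)
      fun_prop
    have h := (hs.homeoOfEquivCompactToT2 (f := s)).symm.continuous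
    have h' : Continuous fun x : G => (s.symm (x, 1)).2 :=
      continuous_snd.comp (h.comp (continuous_id.prodMk continuous_const))
    simpa [s] using h'

end CompactSemigroup

/-! ### Minimal tensor products and characters -/

namespace MinTensor

section

variable {A B C A' B' C' A'' B'' : Type u} [CStarAlgebra A] [CStarAlgebra B] [CStarAlgebra C]
  [CStarAlgebra A'] [CStarAlgebra B'] [CStarAlgebra C'] [CStarAlgebra A''] [CStarAlgebra B'']

lemma map_map (f' : A' →⋆ₐ[ℂ] A'') (g' : B' →⋆ₐ[ℂ] B'') (f : A →⋆ₐ[ℂ] A') (g : B →⋆ₐ[ℂ] B')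
    (t : MinTensor A B) : map f' g' (map f g t) = map (f'.comp f) (g'.comp g) t := by
  have h : (map f' g').comp (map f g) = map (f'.comp f) (g'.comp g) := ext fun a b => by
    rw [StarAlgHom.comp_apply, map_tmul, map_tmul, map_tmul]
    rfl
  exact DFunLike.congr_fun h t

lemma denseRange_map {f : A →⋆ₐ[ℂ] A'} {g : B →⋆ₐ[ℂ] B'} (hf : Function.Surjective f)
    (hg : Function.Surjective g) : DenseRange (map f g) := by
  refine span_tmul_dense.mono ?_
  have h : Submodule.span ℂ {x : MinTensor A' B' | ∃ a b, x = tmul a b} ≤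
      LinearMap.range (map f g).toAlgHom.toLinearMap := by
    rw [Submodule.span_le]
    rintro _ ⟨a, b, rfl⟩
    obtain ⟨a, rfl⟩ := hf a
    obtain ⟨b, rfl⟩ := hg b
    exact ⟨tmul a b, map_tmul f g a b⟩
  exact h

lemma dense_span_of_map {C D : Type*} [CStarAlgebra C] [CStarAlgebra D] (Φ : C →⋆ₐ[ℂ] D)
    (hΦ : DenseRange Φ) {S : Set C} {T : Set D} (hS : Dense (Submodule.span ℂ S : Set C))
    (h : ∀ x ∈ S, Φ x ∈ T) : Dense (Submodule.span ℂ T : Set D) := by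
  refine (hΦ.dense_image (continuous_starAlgHom Φ) hS).mono ?_
  rintro _ ⟨x, hx, rfl⟩
  have hle : Submodule.span ℂ S ≤ (Submodule.span ℂ T).comap Φ.toAlgHom.toLinearMap := by
    rw [Submodule.span_le]
    exact fun x hx => Submodule.subset_span (h x hx)
  exact hle hx

lemma AssocRel.map (f : A →⋆ₐ[ℂ] A') (g : B →⋆ₐ[ℂ] B') (h : C →⋆ₐ[ℂ] C')
    {x : MinTensor (MinTensor A B) C} {y : MinTensor A (MinTensor B C)} (hxy : AssocRel x y) :
    AssocRel (MinTensor.map (MinTensor.map f g) h x) (MinTensor.map f (MinTensor.map g h) y) := by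
  let L := MinTensor.map (MinTensor.map f g) h
  let R := MinTensor.map f (MinTensor.map g h)
  let P : MinTensor (MinTensor A B) C × MinTensor A (MinTensor B C) →ₗ[ℂ] _ × _ :=
    L.toAlgHom.toLinearMap.prodMap R.toAlgHom.toLinearMap
  have hP : Continuous P := (continuous_starAlgHom L).prodMap (continuous_starAlgHom R)
  refine (map_mem_closure (f := P) hP hxy ?_ : P (x, y) ∈ _)
  change Submodule.span ℂ _ ≤ (Submodule.span ℂ _).comap P
  rw [Submodule.span_le]
  rintro _ ⟨a, b, c, rfl⟩
  refine Submodule.subset_span ⟨f a, g b, h c, Prod.ext ?_ ?_⟩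
  · exact (map_tmul _ _ _ _).trans (congrArg (tmul · (h c)) (map_tmul _ _ _ _))
  · exact (map_tmul _ _ _ _).trans (congrArg (tmul (f a)) (map_tmul _ _ _ _))

end

section

variable {A B : Type u} [CStarAlgebra A] [CStarAlgebra B]
  {X Y Z X' Y' : Type u} [TopologicalSpace X] [CompactSpace X] [T2Space X]
  [TopologicalSpace Y] [CompactSpace Y] [T2Space Y]
  [TopologicalSpace Z] [CompactSpace Z] [T2Space Z]
  [TopologicalSpace X'] [CompactSpace X'] [T2Space X']
  [TopologicalSpace Y'] [CompactSpace Y'] [T2Space Y']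

/-- The value of `(f ⊗ g) t` at `(x, y)` depends only on the characters `a ↦ f a x` and
`b ↦ g b y`. -/
lemma toFun_map_congr {f : A →⋆ₐ[ℂ] C(X, ℂ)} {g : B →⋆ₐ[ℂ] C(Y, ℂ)} {f' : A →⋆ₐ[ℂ] C(X', ℂ)}
    {g' : B →⋆ₐ[ℂ] C(Y', ℂ)} {x : X} {y : Y} {x' : X'} {y' : Y'} (hf : ∀ a, f a x = f' a x')
    (hg : ∀ b, g b y = g' b y') (t : MinTensor A B) :
    toFun (map f g t) (x, y) = toFun (map f' g' t) (x', y') := by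
  have h : ((ContinuousMap.evalStarAlgHom ℂ ℂ (x, y)).comp toFun).comp (map f g) =
      ((ContinuousMap.evalStarAlgHom ℂ ℂ (x', y')).comp toFun).comp (map f' g') := by
    refine ext fun a b => ?_
    change toFun (map f g (tmul a b)) (x, y) = toFun (map f' g' (tmul a b)) (x', y')
    rw [map_tmul, map_tmul, toFun_tmul, toFun_tmul, hf, hg]
  exact DFunLike.congr_fun h t

/-- Tensors related by reassociation define the same function of three variables. -/
lemma AssocRel.tripleLeft_eq {x : MinTensor (MinTensor C(X, ℂ) C(Y, ℂ)) C(Z, ℂ)}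
    {y : MinTensor C(X, ℂ) (MinTensor C(Y, ℂ) C(Z, ℂ))} (h : AssocRel x y) :
    tripleLeft x = tripleRight y := by
  let L := tripleLeft (X := X) (Y := Y) (Z := Z)
  let R := tripleRight (X := X) (Y := Y) (Z := Z)
  let P := (L.toAlgHom.toLinearMap ∘ₗ LinearMap.fst ℂ _ _) -
    (R.toAlgHom.toLinearMap ∘ₗ LinearMap.snd ℂ _ _)
  have hP : Continuous P := ((continuous_starAlgHom L).comp continuous_fst).sub
    ((continuous_starAlgHom R).comp continuous_snd)
  have hle : Submodule.span ℂ {p : MinTensor (MinTensor C(X, ℂ) C(Y, ℂ)) C(Z, ℂ) ×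
      MinTensor C(X, ℂ) (MinTensor C(Y, ℂ) C(Z, ℂ)) |
      ∃ a b c, p = (tmul (tmul a b) c, tmul a (tmul b c))} ≤ LinearMap.ker P := by
    rw [Submodule.span_le]
    rintro _ ⟨a, b, c, rfl⟩
    refine LinearMap.mem_ker.mpr (sub_eq_zero.mpr (ContinuousMap.ext fun ⟨p, q, r⟩ => ?_))
    exact (tripleLeft_tmul a b c p q r).trans (tripleRight_tmul a b c p q r).symm
  have hcl : IsClosed {p | P p = 0} := isClosed_singleton.preimage hP
  exact sub_eq_zero.mp (closure_minimal (t := {p | P p = 0}) hle hcl h)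

end

end MinTensor

/-! ### The abelianization of a compact quantum group -/

noncomputable section

namespace CStarQG

open WeakDual MinTensor

variable (A : CStarQG.{u})

/-- The comultiplication followed by restriction to pairs of characters:
`a ↦ ((χ, ψ) ↦ (χ ⊗ ψ) (Δ a))`. -/
def comulCharacters : A →⋆ₐ[ℂ] C(characterSpace ℂ A × characterSpace ℂ A, ℂ) :=
  toFun.comp ((map (gelfandQuotient A) (gelfandQuotient A)).comp A.comul)

/-- The convolution product `(χ, ψ) ↦ (χ ⊗ ψ) ∘ Δ` of characters. -/
def characterMul : C(characterSpace ℂ A × characterSpace ℂ A, characterSpace ℂ A) where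
  toFun p := CharacterSpace.equivAlgHom.symm
    ((ContinuousMap.evalStarAlgHom ℂ ℂ p).comp (comulCharacters A)).toAlgHom
  continuous_toFun := Continuous.subtype_mk
    (continuous_of_continuous_eval fun a => map_continuous (comulCharacters A a)) _

variable {A}

lemma characterMul_apply (p : characterSpace ℂ A × characterSpace ℂ A) (a : A) :
    characterMul A p a = toFun (map (gelfandQuotient A) (gelfandQuotient A) (A.comul a)) p := rfl

variable (A) in
/-- The comultiplication of the abelianization, dual to the product of characters. -/
def abelianizationComul :
    C(characterSpace ℂ A, ℂ) →⋆ₐ[ℂ] MinTensor C(characterSpace ℂ A, ℂ) C(characterSpace ℂ A, ℂ) :=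
  ofFun.comp (ContinuousMap.compStarAlgHom' ℂ ℂ (characterMul A))

lemma abelianizationComul_gelfandQuotient (a : A) : abelianizationComul A (gelfandQuotient A a) =
    map (gelfandQuotient A) (gelfandQuotient A) (A.comul a) := by
  apply toFun_injective
  exact toFun_ofFun _

lemma abelianizationComul_comp : (abelianizationComul A).comp (gelfandQuotient A) =
    (map (gelfandQuotient A) (gelfandQuotient A)).comp A.comul :=
  StarAlgHom.ext abelianizationComul_gelfandQuotient

variable (A) in
/-- The abelianization of a compact quantum group: the continuous functions on the space of
characters. -/
def abelianization : CStarQG.{u} where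
  carrier := C(characterSpace ℂ A, ℂ)
  comul := abelianizationComul A
  coassoc f := by
    obtain ⟨a, rfl⟩ := gelfandQuotient_surjective f
    have h := (A.coassoc a).map (gelfandQuotient A) (gelfandQuotient A) (gelfandQuotient A)
    rw [map_map, map_map, ← abelianizationComul_comp] at h
    rw [abelianizationComul_gelfandQuotient, map_map, map_map]
    exact h
  dense_right := by
    refine dense_span_of_map _ (denseRange_map (gelfandQuotient_surjective (A := A))
      (gelfandQuotient_surjective (A := A))) A.dense_right ?_
    rintro _ ⟨a, b, rfl⟩
    refine ⟨gelfandQuotient A a, gelfandQuotient A b, ?_⟩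
    rw [map_mul, map_tmul, map_one, abelianizationComul_gelfandQuotient]
  dense_left := by
    refine dense_span_of_map _ (denseRange_map (gelfandQuotient_surjective (A := A))
      (gelfandQuotient_surjective (A := A))) A.dense_left ?_
    rintro _ ⟨a, b, rfl⟩
    refine ⟨gelfandQuotient A a, gelfandQuotient A b, ?_⟩
    rw [map_mul, map_tmul, map_one, abelianizationComul_gelfandQuotient]

variable (A) in
/-- The quotient map from a compact quantum group to its abelianization. -/
def toAbelianization : A ⟶ abelianization A :=
  ⟨gelfandQuotient A, fun a => (abelianizationComul_gelfandQuotient a).symm⟩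

lemma existsUnique_desc_abelianization {B : CStarQG.{u}} (hB : isCommutative B) (f : A ⟶ B) :
    ∃! g : abelianization A ⟶ B, toAbelianization A ≫ g = f := by
  let _ : CommCStarAlgebra B := { B.cstar with mul_comm := hB }
  obtain ⟨g, hg, hu⟩ := existsUnique_comp_gelfandQuotient f.hom
  refine ⟨⟨g, fun x => ?_⟩, Hom.ext hg, fun g' hg' => Hom.ext (hu _ (congrArg Hom.hom hg'))⟩
  obtain ⟨a, rfl⟩ := gelfandQuotient_surjective x
  change map g g (abelianizationComul A (gelfandQuotient A a)) = _
  rw [abelianizationComul_gelfandQuotient, map_map, hg, f.map_comul]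
  exact congrArg B.comul (DFunLike.congr_fun hg a).symm

/-! ### The compact group of characters of a compact quantum group -/

/-- Coassociativity, evaluated at three characters. -/
lemma characterMul_assoc (x y z : characterSpace ℂ A) :
    characterMul A (characterMul A (x, y), z) = characterMul A (x, characterMul A (y, z)) := by
  refine CharacterSpace.ext fun a => ?_
  rw [characterMul_apply, characterMul_apply]
  have h := ((A.coassoc a).map (gelfandQuotient A) (gelfandQuotient A)
    (gelfandQuotient A)).tripleLeft_eq
  rw [map_map, map_map] at h
  have h' := DFunLike.congr_fun h (x, (y, z))
  change toFun (map toFun (StarAlgHom.id ℂ _) (map _ _ _)) ((x, y), z) =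
    toFun (map (StarAlgHom.id ℂ _) toFun (map _ _ _)) (x, (y, z)) at h'
  rw [map_map, map_map] at h'
  refine (toFun_map_congr (fun a => ?_) (fun a => ?_) _).trans
    (h'.trans (toFun_map_congr (fun a => ?_) (fun a => ?_) _)) <;> rfl

instance : Semigroup (characterSpace ℂ A) where
  mul x y := characterMul A (x, y)
  mul_assoc := characterMul_assoc

instance : ContinuousMul (characterSpace ℂ A) := ⟨(characterMul A).continuous⟩

/-- The character `χ ⊗ ψ` of the minimal tensor product `A ⊗ A`. -/
def tensorCharacter (x y : characterSpace ℂ A) : MinTensor A A →⋆ₐ[ℂ] ℂ :=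
  (ContinuousMap.evalStarAlgHom ℂ ℂ (x, y)).comp
    (toFun.comp (map (gelfandQuotient A) (gelfandQuotient A)))

lemma tensorCharacter_tmul (x y : characterSpace ℂ A) (a b : A) :
    tensorCharacter x y (tmul a b) = x a * y b := by
  change toFun (map _ _ (tmul a b)) (x, y) = _
  rw [map_tmul, toFun_tmul]
  rfl

lemma tensorCharacter_comul (x y : characterSpace ℂ A) (a : A) :
    tensorCharacter x y (A.comul a) = (x * y) a := rfl

lemma tensorCharacter_eq_of_dense {S : Set (MinTensor A A)}
    (hS : Dense (Submodule.span ℂ S : Set (MinTensor A A)))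
    {x y x' y' : characterSpace ℂ A} (h : ∀ t ∈ S, tensorCharacter x y t = tensorCharacter x' y' t)
    (t : MinTensor A A) : tensorCharacter x y t = tensorCharacter x' y' t :=
  congrFun (Continuous.ext_on hS (continuous_starAlgHom (tensorCharacter x y))
    (continuous_starAlgHom (tensorCharacter x' y')) fun _ ht =>
      LinearMap.eqOn_span (f := (tensorCharacter x y).toAlgHom.toLinearMap)
        (g := (tensorCharacter x' y').toAlgHom.toLinearMap) h ht) t

/-- The density conditions make the product of characters cancellative: if `x y = x' y`, then
`x ⊗ y` and `x' ⊗ y` agree on `Δ(A)(1 ⊗ A)`, hence everywhere. -/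
instance : IsCancelMul (characterSpace ℂ A) where
  mul_left_cancel x y y' h := by
    refine CharacterSpace.ext fun a => ?_
    have h' := tensorCharacter_eq_of_dense A.dense_left (x := x) (y := y) (x' := x) (y' := y') (by
      rintro _ ⟨a, b, rfl⟩
      rw [map_mul, map_mul, tensorCharacter_comul, tensorCharacter_comul, tensorCharacter_tmul,
        tensorCharacter_tmul, map_one, map_one]
      exact congrArg (fun z : characterSpace ℂ A => z a * (x b * 1)) h) (tmul 1 a)
    rwa [tensorCharacter_tmul, tensorCharacter_tmul, map_one, one_mul, one_mul] at h'
  mul_right_cancel y x x' h := by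
    refine CharacterSpace.ext fun a => ?_
    have h' := tensorCharacter_eq_of_dense A.dense_right (x := x) (y := y) (x' := x') (y' := y) (by
      rintro _ ⟨a, b, rfl⟩
      rw [map_mul, map_mul, tensorCharacter_comul, tensorCharacter_comul, tensorCharacter_tmul,
        tensorCharacter_tmul, map_one, map_one]
      exact congrArg (fun z : characterSpace ℂ A => z a * (1 * y b)) h) (tmul a 1)
    rwa [tensorCharacter_tmul, tensorCharacter_tmul, map_one, mul_one, mul_one] at h'

variable (A) in
/-- The compact group of characters of a compact quantum group that has at least one character. -/
def characterGroup [Nonempty (characterSpace ℂ A)] : CompGrp.{u} :=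
  letI := groupOfCompactCancel (characterSpace ℂ A)
  { carrier := characterSpace ℂ A
    topGroup := .of_compact _ }

variable (A) in
/-- The canonical morphism from a compact quantum group to the continuous functions on its character
group. -/
def toContCharacterGroup [Nonempty (characterSpace ℂ A)] : A ⟶ contObj (characterGroup A) where
  hom := gelfandQuotient A
  map_comul a := by
    refine toFun_injective (X := characterGroup A) (Y := characterGroup A)
      (ContinuousMap.ext fun p => ?_)
    exact (toFun_contComul (G := characterGroup A)
      (show C(characterGroup A, ℂ) from gelfandQuotient A a) p).symm

/-- The homomorphism from a compact group `G` to the character group of `A` that corresponds to a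
morphism `A ⟶ C(G)`. -/
def characterOfHom [Nonempty (characterSpace ℂ A)] {G : CompGrp.{u}} (f : A ⟶ contObj G) :
    G ⟶ characterGroup A where
  hom :=
    let F : A →⋆ₐ[ℂ] C(G, ℂ) := f.hom
    let φ : G → characterSpace ℂ A := fun g => CharacterSpace.equivAlgHom.symm
      ((ContinuousMap.evalStarAlgHom ℂ ℂ g).comp F).toAlgHom
    { MonoidHom.mk' (M := G) (G := characterGroup A) φ fun g h => CharacterSpace.ext fun a => by
        refine Eq.trans ?_ (toFun_map_congr (f := F) (g := F) (x := g) (y := h)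
          (f' := gelfandQuotient A) (g' := gelfandQuotient A) (x' := φ g) (y' := φ h)
          (fun _ => rfl) (fun _ => rfl) (A.comul a))
        refine (toFun_contComul (G := G) (F a) (g, h)).symm.trans ?_
        exact congrArg (fun t : MinTensor C(G, ℂ) C(G, ℂ) => toFun t (g, h))
          (f.map_comul a).symm with
      continuous_toFun := Continuous.subtype_mk
        (continuous_of_continuous_eval fun a => (F a).continuous) _ }

/-- The character group of `A` represents the functor `G ↦ (A ⟶ C(G))`. -/
lemma existsUnique_characterGroup [Nonempty (characterSpace ℂ A)] {G : CompGrp.{u}}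
    (f : A ⟶ contObj G) :
    ∃! φ : G ⟶ characterGroup A, toContCharacterGroup A ≫ contFunctor.map φ.op = f := by
  refine ⟨characterOfHom f, Hom.ext (StarAlgHom.ext fun a => rfl), fun φ hφ => ?_⟩
  subst hφ
  rfl

end CStarQG

end

/-! ### Abelianization as a reflection, and limits of commutative diagrams -/

theorem CQG.exists_adjunction_abelianization :
    ∃ (ab : CQG.{u} ⥤ CQG.isCommutative.{u}.FullSubcategory) (adj : ab ⊣ CQG.isCommutative.{u}.ι),
      ∀ A : CQG.{u}, IsLargestCommQuotientStar (CQG.Hom.toStarAlgHom (adj.unit.app A)) :=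
  exists_adjunction_of_universal CQG.isCommutative.ι
    (fun η => IsLargestCommQuotientStar (CQG.Hom.toStarAlgHom η)) fun A =>
      ⟨⟨CQG.abelianization A, mul_comm_quotient_commutatorIdeal⟩, CQG.toAbelianization A,
        CQG.isLargestCommQuotientStar_toAbelianization, fun Z f => by
          obtain ⟨g, hg, hu⟩ := CQG.existsUnique_desc_abelianization Z.property f
          exact ⟨ObjectProperty.homMk g, hg,
            fun g' hg' => ObjectProperty.hom_ext _ (hu g'.hom hg')⟩⟩

theorem CStarQG.exists_adjunction_abelianization :
    ∃ (ab : CStarQG.{u} ⥤ CStarQG.isCommutative.{u}.FullSubcategory)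
      (adj : ab ⊣ CStarQG.isCommutative.{u}.ι),
      ∀ A : CStarQG.{u}, IsLargestCommQuotientCStar (CStarQG.Hom.hom (adj.unit.app A)) :=
  exists_adjunction_of_universal CStarQG.isCommutative.ι
    (fun η => IsLargestCommQuotientCStar (CStarQG.Hom.hom η)) fun A =>
      ⟨⟨CStarQG.abelianization A, fun f g => mul_comm (G := C(_, ℂ)) f g⟩,
        CStarQG.toAbelianization A, isLargestCommQuotientCStar_gelfandQuotient, fun Z f => by
          obtain ⟨g, hg, hu⟩ := CStarQG.existsUnique_desc_abelianization Z.property f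
          exact ⟨ObjectProperty.homMk g, hg,
            fun g' hg' => ObjectProperty.hom_ext _ (hu g'.hom hg')⟩⟩

lemma CQG.isCommutative_of_retraction {A B : CQG.{u}} (hB : isCommutative B) {i : A ⟶ B} {r : B ⟶ A}
    (h : i ≫ r = 𝟙 A) : isCommutative A := by
  have hr : ∀ a, r.hom (i.hom a) = a := fun a => congrArg (fun f : A ⟶ A => f.hom a) h
  intro a b
  rw [← hr a, ← hr b, ← map_mul, hB, map_mul]

lemma CStarQG.isCommutative_of_retraction {A B : CStarQG.{u}} (hB : isCommutative B) {i : A ⟶ B}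
    {r : B ⟶ A} (h : i ≫ r = 𝟙 A) : isCommutative A := by
  have hr : ∀ a, r.hom (i.hom a) = a := fun a => congrArg (fun f : A ⟶ A => f.hom a) h
  intro a b
  rw [← hr a, ← hr b, ← map_mul, hB, map_mul]

/-! ### Colimits of compact groups -/

theorem nonempty_isLimit_repFunctor {J : Type w} [Category.{v} J] {F : J ⥤ CompGrp.{u}}
    {c : Limits.Cocone F} (hc : Limits.IsColimit c) :
    Nonempty (Limits.IsLimit (repFunctor.{u}.mapCone c.op)) :=
  nonempty_isLimit_mapCone_op _ hc fun s =>
    ⟨CQG.characterGroup s.pt, CQG.toRepCharacterGroup s.pt,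
      fun _ f => CQG.existsUnique_characterGroup f⟩

/-- If the diagram is nonempty, then the apex of any cone over `j ↦ C(G j)` has a character: a leg
of the cone followed by the evaluation at `1`. -/
theorem nonempty_isLimit_contFunctor {J : Type w} [Category.{v} J] [Nonempty J]
    {F : J ⥤ CompGrp.{u}} {c : Limits.Cocone F} (hc : Limits.IsColimit c) :
    Nonempty (Limits.IsLimit (contFunctor.{u}.mapCone c.op)) :=
  nonempty_isLimit_mapCone_op _ hc fun s => by
    obtain ⟨j⟩ := ‹Nonempty J›
    let f : s.pt →⋆ₐ[ℂ] C(F.obj j, ℂ) := (s.π.app (Opposite.op j)).hom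
    have : Nonempty (WeakDual.characterSpace ℂ s.pt) :=
      ⟨WeakDual.CharacterSpace.equivAlgHom.symm
        ((ContinuousMap.evalStarAlgHom ℂ ℂ (1 : F.obj j)).comp f).toAlgHom⟩
    exact ⟨CStarQG.characterGroup s.pt, CStarQG.toContCharacterGroup s.pt,
      fun _ f => CStarQG.existsUnique_characterGroup f⟩

theorem mainTheorem10 :
    -- the inclusions of the commutative objects are right adjoints, with abelianization as
    -- left adjoint and the largest commutative quotient map as unit
    ((∃ (ab : CQG.{u} ⥤ CQG.isCommutative.{u}.FullSubcategory)
        (adj : ab ⊣ CQG.isCommutative.{u}.ι),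
        ∀ A : CQG.{u}, IsLargestCommQuotientStar (CQG.Hom.toStarAlgHom (adj.unit.app A))) ∧
      (∃ (ab : CStarQG.{u} ⥤ CStarQG.isCommutative.{u}.FullSubcategory)
        (adj : ab ⊣ CStarQG.isCommutative.{u}.ι),
        ∀ A : CStarQG.{u}, IsLargestCommQuotientCStar (CStarQG.Hom.hom (adj.unit.app A)))) ∧
    -- limits of diagrams with commutative values are commutative
    ((∀ (J : Type w) [Category.{v} J] (F : J ⥤ CQG.{u}), (∀ j, CQG.isCommutative (F.obj j)) →
        ∀ c : Limits.Cone F, Nonempty (Limits.IsLimit c) → CQG.isCommutative c.pt) ∧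
      (∀ (J : Type w) [Category.{v} J] (F : J ⥤ CStarQG.{u}),
        (∀ j, CStarQG.isCommutative (F.obj j)) →
        ∀ c : Limits.Cone F, Nonempty (Limits.IsLimit c) → CStarQG.isCommutative c.pt)) ∧
    -- and they are the limits in the subcategory of commutative objects
    ((∀ (J : Type w) [Category.{v} J] (F : J ⥤ CQG.isCommutative.{u}.FullSubcategory)
        (c : Limits.Cone F), Nonempty (Limits.IsLimit c) ↔
          Nonempty (Limits.IsLimit (CQG.isCommutative.ι.mapCone c))) ∧
      (∀ (J : Type w) [Category.{v} J] (F : J ⥤ CStarQG.isCommutative.{u}.FullSubcategory)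
        (c : Limits.Cone F), Nonempty (Limits.IsLimit c) ↔
          Nonempty (Limits.IsLimit (CStarQG.isCommutative.ι.mapCone c)))) ∧
    -- colimits of compact groups become limits
    ((∀ (J : Type w) [Category.{v} J] (F : J ⥤ CompGrp.{u}) (c : Limits.Cocone F),
        Nonempty (Limits.IsColimit c) →
          Nonempty (Limits.IsLimit (repFunctor.{u}.mapCone c.op))) ∧
      (∀ (J : Type w) [Category.{v} J] [Nonempty J] (F : J ⥤ CompGrp.{u}) (c : Limits.Cocone F),
        Nonempty (Limits.IsColimit c) →
          Nonempty (Limits.IsLimit (contFunctor.{u}.mapCone c.op)))) := by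
  obtain ⟨L, adj, h⟩ := CQG.exists_adjunction_abelianization.{u}
  obtain ⟨L', adj', h'⟩ := CStarQG.exists_adjunction_abelianization.{u}
  refine ⟨⟨⟨L, adj, h⟩, ⟨L', adj', h'⟩⟩, ⟨fun J _ F hF c ⟨hc⟩ => ?_, fun J _ F hF c ⟨hc⟩ => ?_⟩,
    ⟨fun J _ F c => nonempty_isLimit_iff_of_reflective adj F c,
      fun J _ F c => nonempty_isLimit_iff_of_reflective adj' F c⟩,
    ⟨fun J _ F c ⟨hc⟩ => nonempty_isLimit_repFunctor hc,
      fun J _ _ F c ⟨hc⟩ => nonempty_isLimit_contFunctor hc⟩⟩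
  · obtain ⟨r, hr⟩ := exists_retraction_of_isLimit adj hF hc
    exact CQG.isCommutative_of_retraction (L.obj c.pt).property hr
  · obtain ⟨r, hr⟩ := exists_retraction_of_isLimit adj' hF hc
    exact CStarQG.isCommutative_of_retraction (L'.obj c.pt).property hr
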